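/- Let $F$ be a non-archimedean local field of characteristic zero and odd residual characteristic, with ring of integers $\mathfrak{o}_F$, uniformizer $\varpi$, and residue field of cardinality $q$. Let $E=F[\sqrt{\epsilon}]$ ($\epsilon\in\mathfrak{o}_F^\times$ a non-square) be the unramified quadratic extension of $F$, with ring of integers $\mathfrak{o}_E$, $\mathfrak{p}_E^n=\varpi^n\mathfrak{o}_E$ for $n \in \mathbf{Z}$, and non-trivial automorphism $x\mapsto\overline{x}$ over $F$. Let $$G=\{g\in \mathrm{GL}_3(E) : {}^t\overline{g}Jg=J\},\qquad J=\begin{pmatrix}0&0&1\\0&1&0\\1&0&0\end{pmatrix},$$ let $\zeta=\mathrm{diag}(\varpi,1,\varpi^{-1})\in G$, and let $U$ be the group of all $u(x,y)=\begin{pmatrix}1&x&y\\0&1&-\overline{x}\\0&0&1\end{pmatrix}$ with $x,y\in E$ and $y+\overline{y}+x\overline{x}=0$. For $n\ge 0$ put $$K_n=\begin{pmatrix}\mathfrak{o}_E&\mathfrak{o}_E&\mathfrak{p}_E^{-n}\\ \mathfrak{p}_E^n&1+\mathfrak{p}_E^n&\mathfrak{o}_E\\ \mathfrak{p}_E^n&\mathfrak{p}_E^n&\mathfrak{o}_E\end{pmatrix}\cap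 G .$$ Let $Z$ be the center of $G$, identified with the group of norm-one elements of $E^\times$, and put $Z_0=Z$ and $Z_n=Z\cap(1+\mathfrak{p}_E^n)$ for $n\ge1$. Let $\psi_E$ be an additive character of $E$ with conductor $\mathfrak{o}_E$ (trivial on $\mathfrak{o}_E$ but not on $\mathfrak{p}_E^{-1}$). Let $(\pi,V)$ be an irreducible smooth complex representation of $G$ that is generic, and let $l\ne0$ be a Whittaker functional, that is, a linear form on $V$ with $l(\pi(u(x,y))v)=\psi_E(x)l(v)$ for all $u(x,y)\in U$ and $v\in V$. Put $W_v(g)=l(\pi(g)v)$. Let $V(n)$ be the space of $K_n$-fixed vectors in $V$, let $N_\pi=\min\{n\ge0 : V(n)\neq\{0\}\}$, and let $n_\pi=\min\{n\ge0 : \omega_\pi|_{Z_n}=1\}$, where $\omega_\pi$ is the central character of $\pi$. Put $$Tv=\frac{1}{\mathrm{vol}(K_{N_\pi})}\int_{K_{N_\pi}\zeta K_{N_\pi}}\pi(k)v\,dk,\qquad v\in V(N_\pi),$$ where $dk$ is a Haar measure on $G$. Assume that $N_\pi\ge2$ and $N_\pi>n_\pi$. Let $v\in V(N_\pi)$, let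 $\lambda\in\mathbf{C}$ be such that $Tv=\lambda v$ (as $V(N_\pi)$ is one-dimensional, $T$ acts on it by a scalar $\lambda$), and put $c_i=W_v(\zeta^i)$ for $i\in\mathbf{Z}$. Then $$\lambda c_0=q^4c_1,\qquad (\lambda+q^2)c_i=q^4c_{i+1}\quad\text{for all } i\ge1 .$$ -/

import Mathlib

open scoped ValuativeRel

noncomputable section

namespace U21

section Fields

variable (F E : Type*) [Field F] [ValuativeRel F] [Field E] [Algebra F E]

/-- `E = F[√ε]` for a unit `ε` of the ring of integers of `F` that is not a square. For a
nonarchimedean local field `F` of odd residual characteristic this says that `E` is the unramified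
quadratic extension of `F`. -/
def IsUnramifiedQuadratic : Prop :=
  ∃ (ε : 𝒪[F]) (s : E), IsUnit ε ∧ ¬ IsSquare ε ∧
    s ^ 2 = algebraMap F E (ε : F) ∧ Algebra.adjoin F {s} = ⊤

variable {F}

/-- The uniformizer `ϖ` of `F`, seen in `E`. -/
def unif (ϖ : 𝒪[F]) : E := algebraMap F E (ϖ : F)

variable {E}

/-- The power `𝔭_E ^ n = ϖ ^ n 𝔬_E`, for an integer `n`, where `ϖ` is a uniformizer of `F`
(and so of `E` when `E / F` is unramified). -/
def primePow [ValuativeRel E] (ϖ : 𝒪[F]) (n : ℤ) : Set E :=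
  {x | ∃ y : 𝒪[E], x = unif E ϖ ^ n * (y : E)}

/-- The additive character `ψ` of `E` has conductor `𝔬_E`: it is trivial on `𝔬_E` and
nontrivial on `𝔭_E ^ (-1)`. -/
def HasConductorIntegers [ValuativeRel E] (ϖ : 𝒪[F]) (ψ : AddChar E ℂ) : Prop :=
  (∀ x : 𝒪[E], ψ (x : E) = 1) ∧ ∃ x ∈ primePow (E := E) ϖ (-1), ψ x ≠ 1

end Fields

section Group

variable {F E : Type*} [Field F] [Field E] [Algebra F E]

/-- The matrix of the hermitian form. -/
def J (E : Type*) [Field E] : Matrix (Fin 3) (Fin 3) E := !![0, 0, 1; 0, 1, 0; 1, 0, 0]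

/-- The group `G = {g ∈ GL₃(E) | ᵗ(σ g) J g = J}`, where `σ` is the nontrivial element
of `Gal(E/F)`. -/
def G (σ : E ≃ₐ[F] E) : Subgroup (GL (Fin 3) E) where
  carrier := {g | ((g : Matrix (Fin 3) (Fin 3) E).map σ).transpose * J E *
    (g : Matrix (Fin 3) (Fin 3) E) = J E}
  one_mem' := by
    have h : ((1 : Matrix (Fin 3) (Fin 3) E).map σ) = 1 :=
      Matrix.map_one σ (map_zero σ) (map_one σ)
    simp [h]
  mul_mem' := by
    intro a b ha hb
    simp only [Set.mem_ofPred_eq, Units.val_mul] at ha hb ⊢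
    rw [Matrix.map_mul, Matrix.transpose_mul]
    calc _ = ((b : Matrix (Fin 3) (Fin 3) E).map σ).transpose *
          (((a : Matrix (Fin 3) (Fin 3) E).map σ).transpose * J E *
            (a : Matrix (Fin 3) (Fin 3) E)) * (b : Matrix (Fin 3) (Fin 3) E) := by
          simp only [Matrix.mul_assoc]
      _ = J E := by rw [ha, hb]
  inv_mem' := by
    intro a ha
    simp only [Set.mem_ofPred_eq] at ha ⊢
    have h1 : (a : Matrix (Fin 3) (Fin 3) E) * ((a⁻¹ : GL (Fin 3) E) : Matrix _ _ E) = 1 :=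
      a.mul_inv
    have h2 : (((a⁻¹ : GL (Fin 3) E) : Matrix (Fin 3) (Fin 3) E).map σ).transpose *
        ((a : Matrix (Fin 3) (Fin 3) E).map σ).transpose = 1 := by
      rw [← Matrix.transpose_mul, ← Matrix.map_mul, h1,
        Matrix.map_one σ (map_zero σ) (map_one σ), Matrix.transpose_one]
    calc _ = (((a⁻¹ : GL (Fin 3) E) : Matrix (Fin 3) (Fin 3) E).map σ).transpose *
          (((a : Matrix (Fin 3) (Fin 3) E).map σ).transpose * J E *
            (a : Matrix (Fin 3) (Fin 3) E)) *
          ((a⁻¹ : GL (Fin 3) E) : Matrix (Fin 3) (Fin 3) E) := by rw [ha]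
      _ = ((((a⁻¹ : GL (Fin 3) E) : Matrix (Fin 3) (Fin 3) E).map σ).transpose *
          ((a : Matrix (Fin 3) (Fin 3) E).map σ).transpose) * J E *
            ((a : Matrix (Fin 3) (Fin 3) E) *
          ((a⁻¹ : GL (Fin 3) E) : Matrix (Fin 3) (Fin 3) E)) := by
          simp only [Matrix.mul_assoc]
      _ = J E := by rw [h1, h2, one_mul, mul_one]

variable {σ : E ≃ₐ[F] E}

/-- The underlying matrix of an element of `G`. -/
def mat (g : G σ) : Matrix (Fin 3) (Fin 3) E := ((g : GL (Fin 3) E) : Matrix (Fin 3) (Fin 3) E)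

/-- The element `ζ = diag(ϖ, 1, ϖ⁻¹)` of `G`, for `ϖ ∈ F` nonzero. -/
def zeta (σ : E ≃ₐ[F] E) (ϖ : F) (hϖ : ϖ ≠ 0) : G σ :=
  ⟨⟨Matrix.diagonal ![algebraMap F E ϖ, 1, (algebraMap F E ϖ)⁻¹],
    Matrix.diagonal ![(algebraMap F E ϖ)⁻¹, 1, algebraMap F E ϖ],
    by
      have h : algebraMap F E ϖ ≠ 0 := (map_ne_zero _).mpr hϖ
      rw [Matrix.diagonal_mul_diagonal, ← Matrix.diagonal_one]
      congr 1; ext i; fin_cases i <;> simp [h],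
    by
      have h : algebraMap F E ϖ ≠ 0 := (map_ne_zero _).mpr hϖ
      rw [Matrix.diagonal_mul_diagonal, ← Matrix.diagonal_one]
      congr 1; ext i; fin_cases i <;> simp [h]⟩,
    by
      have h : algebraMap F E ϖ ≠ 0 := (map_ne_zero _).mpr hϖ
      change (Matrix.map (Matrix.diagonal ![algebraMap F E ϖ, 1, (algebraMap F E ϖ)⁻¹])
        σ).transpose * J E * Matrix.diagonal ![algebraMap F E ϖ, 1, (algebraMap F E ϖ)⁻¹] = J E
      ext i j
      fin_cases i <;> fin_cases j <;>
        simp [J, Matrix.mul_apply, Fin.sum_univ_three, Matrix.diagonal, h]⟩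

variable [ValuativeRel F] [ValuativeRel E]

/-- The subgroup `K_n` of `G`, the intersection of `G` with
`(𝔬, 𝔬, 𝔭^{-n}; 𝔭^n, 1 + 𝔭^n, 𝔬; 𝔭^n, 𝔭^n, 𝔬)`, as a set. -/
def K (σ : E ≃ₐ[F] E) (ϖ : 𝒪[F]) (n : ℕ) : Set (G σ) :=
  {g | mat g 0 0 ∈ 𝒪[E] ∧ mat g 0 1 ∈ 𝒪[E] ∧ mat g 0 2 ∈ primePow ϖ (-(n : ℤ)) ∧
    mat g 1 0 ∈ primePow ϖ (n : ℤ) ∧ mat g 1 1 - 1 ∈ primePow ϖ (n : ℤ) ∧ mat g 1 2 ∈ 𝒪[E] ∧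
    mat g 2 0 ∈ primePow ϖ (n : ℤ) ∧ mat g 2 1 ∈ primePow ϖ (n : ℤ) ∧ mat g 2 2 ∈ 𝒪[E]}

/-- The filtration of the center `Z ≅ E¹` of `G`: `Z_0 = Z` and `Z_n = Z ∩ (1 + 𝔭_E^n)` for
`n ≥ 1`. The center consists of the scalar matrices in `G`. -/
def Zn (σ : E ≃ₐ[F] E) (ϖ : 𝒪[F]) (n : ℕ) : Set (G σ) :=
  {g | ∃ z : E, mat g = Matrix.scalar (Fin 3) z ∧ (n = 0 ∨ z - 1 ∈ primePow ϖ (n : ℤ))}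

end Group

section Rep

variable {F E : Type*} [Field F] [Field E] [Algebra F E] {σ : E ≃ₐ[F] E}
variable {V : Type*} [AddCommGroup V] [Module ℂ V] (π : Representation ℂ (G σ) V)

/-- Smoothness: every vector has an open stabilizer. -/
def IsSmoothRep [TopologicalSpace E] : Prop := ∀ v : V, IsOpen {g : G σ | π g v = v}

/-- The space `Hom_U(π, ψ)` of Whittaker functionals: linear forms `l` with
`l (π(u(x, y)) v) = ψ(x) l(v)` for all `u(x, y) ∈ U`. -/
def whittakerFunctionals (ψ : AddChar E ℂ) : Submodule ℂ (Module.Dual ℂ V) where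
  carrier := {l | ∀ (u : G σ) (x y : E), mat u = !![1, x, y; 0, 1, -σ x; 0, 0, 1] →
    ∀ v : V, l (π u v) = ψ x * l v}
  zero_mem' := by intro u x y _ v; simp
  add_mem' := by
    intro a b ha hb u x y hu v
    simp [ha u x y hu v, hb u x y hu v, mul_add]
  smul_mem' := by
    intro c a ha u x y hu v
    simp [ha u x y hu v, mul_left_comm]

/-- The Whittaker function `W_v(g) = l(π(g) v)`. -/
def whittaker (l : Module.Dual ℂ V) (v : V) (g : G σ) : ℂ := l (π g v)

/-- The vectors fixed by a set of elements of `G`. -/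
def fixedBy (S : Set (G σ)) : Submodule ℂ V where
  carrier := {v | ∀ k ∈ S, π k v = v}
  zero_mem' := by intro k _; simp
  add_mem' := by intro a b ha hb k hk; rw [map_add, ha k hk, hb k hk]
  smul_mem' := by intro c a ha k hk; rw [map_smul, ha k hk]

section Integral

variable [MeasurableSpace (G σ)]

/-- `w` is the integral of `f : G → V` over `S`, tested against all linear forms on `V`. -/
def IsVectorIntegral (μ : MeasureTheory.Measure (G σ)) (S : Set (G σ)) (f : G σ → V) (w : V) :
    Prop :=
  ∀ φ : Module.Dual ℂ V, MeasureTheory.IntegrableOn (fun g => φ (f g)) S μ ∧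
    ∫ g in S, φ (f g) ∂μ = φ w

open Classical in
/-- The integral of `f : G → V` over `S`. It is unique as linear forms separate the points of `V`,
and it exists when `f` is locally constant on the compact open set `S`; where there is none
the value is `0`. -/
def vectorIntegral (μ : MeasureTheory.Measure (G σ)) (S : Set (G σ)) (f : G σ → V) : V :=
  if h : ∃ w, IsVectorIntegral μ S f w then h.choose else 0

end Integral

variable [ValuativeRel F] [ValuativeRel E]

/-- The space `V(n)` of `K_n`-fixed vectors. -/
def fixedK (ϖ : 𝒪[F]) (n : ℕ) : Submodule ℂ V := fixedBy π (K σ ϖ n)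

/-- The conductor `N_π = min {n ≥ 0 | V(n) ≠ 0}` of `π`. -/
def conductor (ϖ : 𝒪[F]) : ℕ := sInf {n | fixedK π ϖ n ≠ ⊥}

/-- The conductor `n_π = min {n ≥ 0 | ω_π|_{Z_n} = 1}` of the central character `ω_π`. As
`π(z) = ω_π(z) id` and `V ≠ 0`, `ω_π` is trivial on `Z_n` when `Z_n` acts trivially on `V`. -/
def centralConductor (ϖ : 𝒪[F]) : ℕ := sInf {n | ∀ z ∈ Zn σ ϖ n, π z = 1}

/-- The Hecke operator `T v = vol(K_n)⁻¹ ∫_{K_n ζ K_n} π(k) v dk` at level `n`. -/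
def heckeT [MeasurableSpace (G σ)] (μ : MeasureTheory.Measure (G σ)) (ϖ : 𝒪[F])
    (hϖ : (ϖ : F) ≠ 0) (n : ℕ) (v : V) : V :=
  ((μ.real (K σ ϖ n) : ℂ))⁻¹ •
    vectorIntegral μ (DoubleCoset.doubleCoset (zeta σ (ϖ : F) hϖ) (K σ ϖ n) (K σ ϖ n))
      (fun k => π k v)

end Rep

end U21

end

/-!
The Whittaker function of a newform `v` of level `N = n + 1` is computed along the powers of `ζ` by
combining two coset decompositions.

Let `K_n` be the group of level `n` and `t_n` the antidiagonal element
`(ϖ ^ (-n), 1, ϖ ^ n)` in it. The left cosets in `K_n` of `K_n ∩ ζ L ζ⁻¹`, where `L` is `K_n` or the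
variant of `K_{n + 1}` with central entry in `1 + 𝔭_E ^ n`, are determined by the last column of a
matrix: it is isotropic, so it is proportional to the last column of some `u(x, y)` when its lower
entry is a unit, and of some `t_n u(x, y)` otherwise, and only `x` modulo `𝔭_E` and `y` modulo a
power of `𝔭_E` matter (`existsUnique_cosetRep`).

At level `N`, with `L = K_N`, this writes `T v` as a sum of `q ^ 4` vectors `π(u(x, y) ζ) v` and of
`q ^ 3` vectors `π(t_N u(x, y) ζ) v` (`heckeT_eq`). As `ψ` is trivial on `𝔬_E`, the value at `ζ ^ i`
of the Whittaker function of the first sum is `q ^ 4 c_{i + 1}` for `i ≥ 0`.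

The second sum `S` is evaluated by a trace. As the central character is trivial on `Z_n`, the vector
`v` is fixed by the variant of `K_N` above (`apply_eq_self_of_mem_levelSet`), and therefore the sum
of the translates of `π(ζ) v` over the corresponding cosets in `K_n` is fixed by `K_n`
(`sum_cosets_invariant`), hence zero by minimality of `N`. Applying `t_n` and using
`ζ t_{n + 1} = t_n`, the contribution of the big cell becomes `π(ζ) S`, so that
`π(ζ) S = - ∑_x π(u(x, -x σ(x) / 2) ζ) v`, with `x` in `𝔬_E / 𝔭_E` (`sum_weyl_unip_add`). The value
at `ζ ^ (i - 1)` of the Whittaker function of the right-hand side is `-∑_x ψ(ϖ ^ (i - 1) x) c_i`,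
which is `-q ^ 2 c_i` for `i ≥ 1`, and zero for `i = 0` because `ψ` has conductor `𝔬_E`.

All computations in `E` use coordinates `a + b s` with `s ^ 2` a nonsquare unit of `F`: by Hensel's
lemma the valuation of `a + b s` is the maximum of those of `a` and `b`
(`IsUnramifiedQuadratic.exists_isUnitSqrt`).
-/

noncomputable section

set_option linter.unusedSectionVars false

namespace U21

/-! ### Coordinates on the unramified quadratic extension -/

section Coordinates

open ValuativeRel

variable {F E : Type*} [Field F] [ValuativeRel F] [Field E] [ValuativeRel E] [Algebra F E]
  [ValuativeExtension F E]

theorem valuation_algebraMap_le_iff (a b : F) :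
    valuation E (algebraMap F E a) ≤ valuation E (algebraMap F E b) ↔
      valuation F a ≤ valuation F b := by
  rw [← Valuation.Compatible.vle_iff_le (v := valuation E), ValuativeExtension.vle_iff_vle,
    Valuation.Compatible.vle_iff_le (v := valuation F)]

theorem valuation_algebraMap_le_one_iff (a : F) :
    valuation E (algebraMap F E a) ≤ 1 ↔ valuation F a ≤ 1 := by
  simpa using valuation_algebraMap_le_iff (E := E) a 1

theorem valuation_algebraMap_lt_one_iff (a : F) :
    valuation E (algebraMap F E a) < 1 ↔ valuation F a < 1 := by
  have := valuation_algebraMap_le_iff (E := E) 1 a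
  simp only [map_one] at this
  rw [← not_le, ← not_le, this]

theorem valuation_algebraMap_eq_one_iff (a : F) :
    valuation E (algebraMap F E a) = 1 ↔ valuation F a = 1 := by
  rw [le_antisymm_iff, le_antisymm_iff, valuation_algebraMap_le_one_iff,
    ← not_lt (a := valuation E _), valuation_algebraMap_lt_one_iff, not_lt]

theorem valuation_integer_lt_one_iff (a : 𝒪[F]) :
    valuation F (a : F) < 1 ↔ a ∈ IsLocalRing.maximalIdeal 𝒪[F] := by
  rw [IsLocalRing.mem_maximalIdeal, mem_nonunits_iff,
    Valuation.Integers.isUnit_iff_valuation_eq_one (Valuation.integer.integers (valuation F))]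
  exact ⟨fun h => h.ne, fun h => lt_of_le_of_ne a.2 h⟩

theorem isUnit_iff_valuation_eq_one (a : 𝒪[F]) : IsUnit a ↔ valuation F (a : F) = 1 :=
  Valuation.Integers.isUnit_iff_valuation_eq_one (Valuation.integer.integers (valuation F))

/-- What is needed of a square root `s` of a nonsquare unit of `F` in `E`: every element of `E` has
coordinates `a + b s`, conjugation is `s ↦ -s`, and the valuation of `E` is the maximum of the
valuations of the coordinates (so the coordinates are unique, and `𝔭_E ^ n` is described by
them). -/
structure IsUnitSqrt (σ : E ≃ₐ[F] E) (s : E) : Prop where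
  conj : σ s = -s
  val : ∀ a b : F, valuation E (algebraMap F E a + algebraMap F E b * s) =
    max (valuation E (algebraMap F E a)) (valuation E (algebraMap F E b))
  span : ∀ x : E, ∃ a b : F, x = algebraMap F E a + algebraMap F E b * s

theorem isUnit_two [IsLocalRing 𝒪[F]] (hp : ringChar 𝓀[F] ≠ 2) : IsUnit (2 : 𝒪[F]) := by
  by_contra h
  have h2 : IsLocalRing.residue 𝒪[F] 2 = 0 :=
    (IsLocalRing.residue_eq_zero_iff _).2 ((IsLocalRing.mem_maximalIdeal _).2 h)
  have : ((2 : ℕ) : 𝓀[F]) = 0 := by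
    rw [← map_natCast (IsLocalRing.residue 𝒪[F])]
    exact_mod_cast h2
  rw [ringChar.spec] at this
  rcases (Nat.dvd_prime Nat.prime_two).1 this with h | h
  · have := ringChar.spec 𝓀[F] 1
    rw [h] at this
    simp at this
  · exact hp h

/-- Hensel's lemma for square roots: a unit that is a square in the residue field of odd
characteristic is a square. -/
theorem isSquare_of_sub_mem [TopologicalSpace F] [IsNonarchimedeanLocalField F]
    (hp : ringChar 𝓀[F] ≠ 2) {t ε : 𝒪[F]} (ht : IsUnit t)
    (h : t ^ 2 - ε ∈ IsLocalRing.maximalIdeal 𝒪[F]) : IsSquare ε := by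
  let := IsTopologicalAddGroup.rightUniformSpace F
  have := isUniformAddGroup_of_addCommGroup (G := F)
  obtain ⟨a, ha, -⟩ := HenselianRing.is_henselian (I := IsLocalRing.maximalIdeal 𝒪[F])
    (Polynomial.X ^ 2 - Polynomial.C ε) (Polynomial.monic_X_pow_sub_C ε two_ne_zero) t
    (by simpa using h)
    (by
      have : IsUnit (2 * t) := (isUnit_two hp).mul ht
      have e : (Polynomial.X ^ 2 - Polynomial.C ε).derivative.eval t = 2 * t := by
        simp [one_add_one_eq_two]
      rw [e]
      exact this.map _)
  refine ⟨a, ?_⟩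
  have : a ^ 2 - ε = 0 := by simpa using ha
  rw [← pow_two]
  exact (sub_eq_zero.1 this).symm

theorem IsUnramifiedQuadratic.exists_isUnitSqrt [TopologicalSpace F] [IsNonarchimedeanLocalField F]
    (hp : ringChar 𝓀[F] ≠ 2) (hE : IsUnramifiedQuadratic F E) {σ : E ≃ₐ[F] E} (hσ : σ ≠ 1) :
    ∃ s, IsUnitSqrt σ s := by
  obtain ⟨ε, s, hu, hsq, hs, htop⟩ := hE
  have hvs : valuation E s = 1 := by
    have h1 : valuation E s ^ 2 = 1 := by
      rw [← map_pow, hs, valuation_algebraMap_eq_one_iff]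
      exact (isUnit_iff_valuation_eq_one _).1 hu
    exact (pow_eq_one_iff_of_nonneg zero_le two_ne_zero).1 h1
  have key : ∀ t : F, ¬ valuation E (algebraMap F E t + s) < 1 := by
    intro t ht
    have hvt : valuation E (algebraMap F E t) = 1 := by
      have : valuation E ((algebraMap F E t + s) - s) = valuation E s :=
        Valuation.map_sub_eq_of_lt_right _ (by rwa [hvs])
      rwa [add_sub_cancel_right, hvs] at this
    have hvF : valuation F t = 1 := (valuation_algebraMap_eq_one_iff t).1 hvt
    refine hsq (isSquare_of_sub_mem hp (t := ⟨t, hvF.le⟩)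
      ((isUnit_iff_valuation_eq_one _).2 hvF) ((valuation_integer_lt_one_iff _).1 ?_))
    rw [← valuation_algebraMap_lt_one_iff (E := E)]
    have : algebraMap F E (((⟨t, hvF.le⟩ : 𝒪[F]) ^ 2 - ε : 𝒪[F]) : F) =
        (algebraMap F E t + s) * (algebraMap F E t - s) := by
      change algebraMap F E (t ^ 2 - ε) = _
      rw [map_sub, map_pow, ← hs]
      ring
    rw [this, map_mul]
    refine mul_lt_one_of_lt_of_le ht ((Valuation.map_sub _ _ _).trans ?_)
    simp [hvt, hvs]
  refine ⟨s, ?_, ?_, ?_⟩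
  · have hσs : (σ s - s) * (σ s + s) = 0 := by
      have : σ s ^ 2 = s ^ 2 := by rw [← map_pow, hs, AlgEquiv.commutes]
      linear_combination this
    rcases mul_eq_zero.1 hσs with h | h
    · refine absurd ?_ hσ
      have : (σ : E →ₐ[F] E) = AlgHom.id F E := by
        refine AlgHom.ext_of_adjoin_eq_top htop ?_
        rintro _ rfl
        simpa using sub_eq_zero.1 h
      ext x
      simpa using DFunLike.congr_fun this x
    · exact eq_neg_of_add_eq_zero_left h
  · intro a b
    by_cases hb : b = 0
    · simp [hb]
    by_cases hab : valuation E (algebraMap F E a) = valuation E (algebraMap F E b)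
    · have hb' : algebraMap F E b ≠ 0 := (map_ne_zero _).2 hb
      have h1 : algebraMap F E a + algebraMap F E b * s =
          algebraMap F E b * (algebraMap F E (a / b) + s) := by
        rw [map_div₀]; field_simp
      rw [h1, map_mul, hab, max_self]
      have h2 : valuation E (algebraMap F E (a / b)) = 1 := by
        rw [map_div₀, map_div₀, hab, div_self]
        exact (Valuation.ne_zero_iff _).2 hb'
      have h3 : valuation E (algebraMap F E (a / b) + s) = 1 := by
        refine le_antisymm ?_ (not_lt.1 (key _))
        exact (Valuation.map_add _ _ _).trans (by rw [h2, hvs, max_self])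
      rw [h3, mul_one]
    · have : valuation E (algebraMap F E b * s) = valuation E (algebraMap F E b) := by
        rw [map_mul, hvs, mul_one]
      rw [Valuation.map_add_of_distinct_val _ (by rwa [this]), this]
  · intro x
    have hx : x ∈ Algebra.adjoin F {s} := by rw [htop]; trivial
    induction hx using Algebra.adjoin_induction with
    | mem x hx => exact ⟨0, 1, by simp [Set.mem_singleton_iff.1 hx]⟩
    | algebraMap r => exact ⟨r, 0, by simp⟩
    | add x y _ _ hx hy =>
      obtain ⟨a, b, rfl⟩ := hx
      obtain ⟨a', b', rfl⟩ := hy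
      exact ⟨a + a', b + b', by push_cast [map_add]; ring⟩
    | mul x y _ _ hx hy =>
      obtain ⟨a, b, rfl⟩ := hx
      obtain ⟨a', b', rfl⟩ := hy
      refine ⟨a * a' + b * b' * (ε : F), a * b' + b * a', ?_⟩
      simp only [map_add, map_mul]
      linear_combination (algebraMap F E b) * (algebraMap F E b') * hs

end Coordinates

/-! ### The lattices `𝔭_E ^ n` -/

section Lattices

open ValuativeRel

variable {F E : Type*} [Field F] [ValuativeRel F] [Field E] [ValuativeRel E] [Algebra F E]
  {ϖ : 𝒪[F]} {σ : E ≃ₐ[F] E} {s : E} {m n : ℤ} {x y : E}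

theorem unif_ne_zero (hϖ : Irreducible ϖ) : unif E ϖ ≠ 0 :=
  (map_ne_zero _).2 fun h => hϖ.ne_zero (Subtype.ext h)

theorem val_unif_ne_zero (hϖ : Irreducible ϖ) : valuation E (unif E ϖ) ≠ 0 :=
  (Valuation.ne_zero_iff _).2 (unif_ne_zero hϖ)

theorem mem_primePow (hϖ : Irreducible ϖ) :
    x ∈ primePow ϖ n ↔ valuation E x ≤ valuation E (unif E ϖ) ^ n := by
  have h0 := unif_ne_zero (E := E) hϖ
  have h1 : 0 < valuation E (unif E ϖ) ^ n :=
    zpow_pos (zero_lt_iff.2 (val_unif_ne_zero hϖ)) n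
  constructor
  · rintro ⟨y, rfl⟩
    rw [map_mul, map_zpow₀]
    exact mul_le_of_le_one_right' y.2
  · intro h
    refine ⟨⟨(unif E ϖ ^ n)⁻¹ * x, ?_⟩, ?_⟩
    · rw [Valuation.mem_integer_iff, map_mul, map_inv₀, map_zpow₀, inv_mul_le_iff₀ h1, mul_one]
      exact h
    · rw [mul_inv_cancel_left₀ (zpow_ne_zero _ h0)]

theorem primePow_zero (hϖ : Irreducible ϖ) : (primePow ϖ 0 : Set E) = 𝒪[E] := by
  ext x
  rw [mem_primePow hϖ, zpow_zero]
  rfl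

theorem add_mem_primePow (hϖ : Irreducible ϖ) (hx : x ∈ primePow ϖ n) (hy : y ∈ primePow ϖ n) :
    x + y ∈ primePow ϖ n := by
  rw [mem_primePow hϖ] at *
  exact Valuation.map_add_le _ hx hy

theorem neg_mem_primePow_iff (hϖ : Irreducible ϖ) : -x ∈ primePow ϖ n ↔ x ∈ primePow ϖ n := by
  rw [mem_primePow hϖ, mem_primePow hϖ, Valuation.map_neg]

theorem sub_mem_primePow (hϖ : Irreducible ϖ) (hx : x ∈ primePow ϖ n) (hy : y ∈ primePow ϖ n) :
    x - y ∈ primePow ϖ n := by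
  rw [sub_eq_add_neg]
  exact add_mem_primePow hϖ hx ((neg_mem_primePow_iff hϖ).2 hy)

theorem zero_mem_primePow : (0 : E) ∈ primePow ϖ n := ⟨0, by simp⟩

theorem mul_mem_primePow (hϖ : Irreducible ϖ) (hx : x ∈ primePow ϖ m) (hy : y ∈ primePow ϖ n) :
    x * y ∈ primePow ϖ (m + n) := by
  rw [mem_primePow hϖ] at *
  rw [map_mul, zpow_add₀ (val_unif_ne_zero hϖ)]
  exact mul_le_mul' hx hy

theorem unif_zpow_mem (hϖ : Irreducible ϖ) (n : ℤ) : unif E ϖ ^ n ∈ primePow ϖ n := by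
  rw [mem_primePow hϖ, map_zpow₀]

theorem unif_zpow_mul_mem_iff (hϖ : Irreducible ϖ) (k : ℤ) :
    unif E ϖ ^ k * x ∈ primePow ϖ n ↔ x ∈ primePow ϖ (n - k) := by
  have h1 : 0 < valuation E (unif E ϖ) ^ k :=
    zpow_pos (zero_lt_iff.2 (val_unif_ne_zero hϖ)) k
  rw [mem_primePow hϖ, mem_primePow hϖ, map_mul, map_zpow₀, zpow_sub₀ (val_unif_ne_zero hϖ),
    le_div_iff₀ h1, mul_comm]

theorem one_mem_primePow (hϖ : Irreducible ϖ) : (1 : E) ∈ primePow ϖ 0 := by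
  rw [mem_primePow hϖ]; simp

variable [ValuativeExtension F E]

theorem val_unif_lt_one (hϖ : Irreducible ϖ) [IsLocalRing 𝒪[F]] : valuation E (unif E ϖ) < 1 := by
  rw [unif, valuation_algebraMap_lt_one_iff, valuation_integer_lt_one_iff]
  exact (IsLocalRing.mem_maximalIdeal _).2 hϖ.not_isUnit

theorem primePow_mono (hϖ : Irreducible ϖ) [IsLocalRing 𝒪[F]] (h : m ≤ n)
    (hx : x ∈ primePow ϖ n) : x ∈ primePow ϖ m := by
  rw [mem_primePow hϖ] at *
  exact hx.trans (zpow_le_zpow_right_of_le_one₀ (zero_lt_iff.2 (val_unif_ne_zero hϖ))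
    (val_unif_lt_one hϖ).le h)

namespace IsUnitSqrt

theorem val_s (hs : IsUnitSqrt σ s) : valuation E s = 1 := by
  simpa using hs.val 0 1

theorem mem_iff (hs : IsUnitSqrt σ s) (hϖ : Irreducible ϖ) (a b : F) :
    algebraMap F E a + algebraMap F E b * s ∈ primePow ϖ n ↔
      algebraMap F E a ∈ primePow ϖ n ∧ algebraMap F E b ∈ primePow ϖ n := by
  rw [mem_primePow hϖ, mem_primePow hϖ, mem_primePow hϖ, hs.val, max_le_iff]

theorem mul_s_mem_iff (hs : IsUnitSqrt σ s) (hϖ : Irreducible ϖ) :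
    x * s ∈ primePow ϖ n ↔ x ∈ primePow ϖ n := by
  rw [mem_primePow hϖ, mem_primePow hϖ, map_mul, hs.val_s, mul_one]

theorem val_conj (hs : IsUnitSqrt σ s) (x : E) : valuation E (σ x) = valuation E x := by
  obtain ⟨a, b, rfl⟩ := hs.span x
  have : σ (algebraMap F E a + algebraMap F E b * s) =
      algebraMap F E a + algebraMap F E (-b) * s := by
    rw [map_add, map_mul, hs.conj, AlgEquiv.commutes, AlgEquiv.commutes, map_neg]; ring
  rw [this, hs.val, hs.val, map_neg, Valuation.map_neg]

theorem conj_mem_iff (hs : IsUnitSqrt σ s) (hϖ : Irreducible ϖ) :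
    σ x ∈ primePow ϖ n ↔ x ∈ primePow ϖ n := by
  rw [mem_primePow hϖ, mem_primePow hϖ, hs.val_conj]

theorem conj_conj (hs : IsUnitSqrt σ s) (x : E) : σ (σ x) = x := by
  obtain ⟨a, b, rfl⟩ := hs.span x
  simp [hs.conj]

/-- `ϖ` is also a uniformizer of `E`. -/
theorem val_le_of_lt_one (hs : IsUnitSqrt σ s) (hϖ : Irreducible ϖ) [TopologicalSpace F]
    [IsNonarchimedeanLocalField F] (h : valuation E x < 1) :
    valuation E x ≤ valuation E (unif E ϖ) := by
  have key : ∀ a : F, valuation E (algebraMap F E a) < 1 →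
      valuation E (algebraMap F E a) ≤ valuation E (unif E ϖ) := by
    intro a ha
    rw [valuation_algebraMap_lt_one_iff] at ha
    have h1 := (valuation_integer_lt_one_iff (⟨a, ha.le⟩ : 𝒪[F])).1 ha
    rw [hϖ.maximalIdeal_eq, Ideal.mem_span_singleton] at h1
    obtain ⟨c, hc⟩ := h1
    have h2 : a = (ϖ : F) * c := congrArg Subtype.val hc
    rw [h2, map_mul, map_mul]
    exact mul_le_of_le_one_right' ((valuation_algebraMap_le_one_iff _).2 c.2)
  obtain ⟨a, b, rfl⟩ := hs.span x
  rw [hs.val, max_lt_iff] at h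
  rw [hs.val]
  exact max_le (key a h.1) (key b h.2)

theorem val_eq_of_not_mem (hs : IsUnitSqrt σ s) (hϖ : Irreducible ϖ) [TopologicalSpace F]
    [IsNonarchimedeanLocalField F] (hx : x ∈ primePow ϖ n) (hx' : x ∉ primePow ϖ (n + 1)) :
    valuation E x = valuation E (unif E ϖ) ^ n := by
  have h0 := val_unif_ne_zero (E := E) hϖ
  have h1 : 0 < valuation E (unif E ϖ) ^ n := zpow_pos (zero_lt_iff.2 h0) n
  rw [mem_primePow hϖ] at hx hx'
  by_contra hne
  refine hx' ?_
  have h2 : valuation E (unif E ϖ ^ (-n) * x) < 1 := by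
    rw [map_mul, map_zpow₀, zpow_neg, inv_mul_lt_iff₀ h1, mul_one]
    exact lt_of_le_of_ne hx hne
  have h3 := hs.val_le_of_lt_one hϖ h2
  rwa [map_mul, map_zpow₀, zpow_neg, inv_mul_le_iff₀ h1, ← zpow_add_one₀ h0] at h3

theorem inv_mem (hs : IsUnitSqrt σ s) (hϖ : Irreducible ϖ) [TopologicalSpace F]
    [IsNonarchimedeanLocalField F] (hx : x ∈ primePow ϖ n) (hx' : x ∉ primePow ϖ (n + 1)) :
    x⁻¹ ∈ primePow ϖ (-n) := by
  rw [mem_primePow hϖ, map_inv₀, hs.val_eq_of_not_mem hϖ hx hx', zpow_neg]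

end IsUnitSqrt

theorem two_mul_mem_iff [TopologicalSpace F] [IsNonarchimedeanLocalField F]
    (hp : ringChar 𝓀[F] ≠ 2) (hϖ : Irreducible ϖ) :
    2 * x ∈ primePow ϖ n ↔ x ∈ primePow ϖ n := by
  have h2 : valuation E (2 : E) = 1 := by
    have := (isUnit_iff_valuation_eq_one _).1 (isUnit_two hp)
    rw [← map_ofNat (algebraMap F E) 2, valuation_algebraMap_eq_one_iff]
    exact this
  rw [mem_primePow hϖ, mem_primePow hϖ, map_mul, h2, one_mul]

theorem half_mem_iff [TopologicalSpace F] [IsNonarchimedeanLocalField F]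
    [CharZero F] (hp : ringChar 𝓀[F] ≠ 2) (hϖ : Irreducible ϖ) :
    x / 2 ∈ primePow ϖ n ↔ x ∈ primePow ϖ n := by
  have : (2 : E) ≠ 0 := by
    rw [← map_ofNat (algebraMap F E) 2]
    exact (map_ne_zero _).2 two_ne_zero
  rw [← two_mul_mem_iff hp hϖ, mul_div_cancel₀ _ this]

end Lattices

/-! ### Systems of representatives -/

section Representatives

open ValuativeRel

variable {F E : Type*} [Field F] [ValuativeRel F] [Field E] [ValuativeRel E] [Algebra F E]
  [ValuativeExtension F E] {ϖ : 𝒪[F]} {σ : E ≃ₐ[F] E} {s : E}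

/-- The family `X` represents `𝔬_E / 𝔭_E`. -/
def IsResidueSystem (ϖ : 𝒪[F]) {ι : Type*} (X : ι → E) : Prop :=
  (∀ i, X i ∈ primePow ϖ 0) ∧ ∀ x ∈ primePow (E := E) ϖ 0, ∃! i, x - X i ∈ primePow ϖ 1

/-- The family `c` of elements of `F` represents `𝔭_F ^ m / 𝔭_F ^ k`, where `𝔭_F ^ m` is viewed as
`F ∩ 𝔭_E ^ m`. -/
def IsLatticeSystem (E : Type*) [Field E] [ValuativeRel E] [Algebra F E] (ϖ : 𝒪[F])
    {ι : Type*} (c : ι → F) (m k : ℤ) : Prop :=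
  (∀ i, algebraMap F E (c i) ∈ primePow ϖ m) ∧
    ∀ y : F, algebraMap F E y ∈ primePow ϖ m → ∃! i, algebraMap F E (y - c i) ∈ primePow ϖ k

theorem isLatticeSystem_unit (m : ℤ) :
    IsLatticeSystem E ϖ (fun _ : Unit => (0 : F)) m m :=
  ⟨fun _ => by simpa using zero_mem_primePow, fun y hy => ⟨(), by simpa using hy, fun _ _ => rfl⟩⟩

theorem IsLatticeSystem.add (hϖ : Irreducible ϖ) [IsLocalRing 𝒪[F]] {ι κ : Type*} {c : ι → F}
    {d : κ → F} {m k r : ℤ} (hmk : m ≤ k) (hkr : k ≤ r)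
    (hc : IsLatticeSystem E ϖ c m k) (hd : IsLatticeSystem E ϖ d k r) :
    IsLatticeSystem E ϖ (fun i : ι × κ => c i.1 + d i.2) m r := by
  refine ⟨fun i => ?_, fun y hy => ?_⟩
  · rw [map_add]
    exact add_mem_primePow hϖ (hc.1 _) (primePow_mono hϖ hmk (hd.1 _))
  · obtain ⟨i, hi, hi'⟩ := hc.2 y hy
    obtain ⟨j, hj, hj'⟩ := hd.2 (y - c i) hi
    refine ⟨(i, j), by simpa only [← sub_sub] using hj, ?_⟩
    rintro ⟨i₁, j₁⟩ h
    simp only at h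
    have h1 : i₁ = i := by
      refine hi' _ ?_
      have := add_mem_primePow hϖ (primePow_mono hϖ hkr h) (hd.1 j₁)
      rw [← map_add] at this
      simpa only [← sub_sub, sub_add_cancel] using this
    subst h1
    rw [hj' j₁ (by simpa only [sub_sub] using h)]

/-- A set-theoretic section of the reduction map `𝔬_F → 𝓀_F`. -/
def lift (F : Type*) [Field F] [ValuativeRel F] [IsLocalRing 𝒪[F]] (a : 𝓀[F]) : 𝒪[F] :=
  Function.surjInv IsLocalRing.residue_surjective a

variable [TopologicalSpace F] [IsNonarchimedeanLocalField F]

@[simp]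
theorem residue_lift (a : 𝓀[F]) : IsLocalRing.residue 𝒪[F] (lift F a) = a :=
  Function.surjInv_eq _ a

theorem integer_mem (hϖ : Irreducible ϖ) (a : 𝒪[F]) :
    algebraMap F E (a : F) ∈ primePow ϖ 0 := by
  rw [mem_primePow hϖ, zpow_zero, valuation_algebraMap_le_one_iff]
  exact a.2

theorem sub_mem_iff_residue_eq (hs : IsUnitSqrt σ s) (hϖ : Irreducible ϖ) (a b : 𝒪[F]) :
    algebraMap F E ((a : F) - b) ∈ primePow ϖ 1 ↔
      IsLocalRing.residue 𝒪[F] a = IsLocalRing.residue 𝒪[F] b := by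
  rw [mem_primePow hϖ, zpow_one, ← sub_eq_zero, ← map_sub, IsLocalRing.residue_eq_zero_iff,
    ← valuation_integer_lt_one_iff, ← valuation_algebraMap_lt_one_iff (E := E)]
  exact ⟨fun h => h.trans_lt (val_unif_lt_one hϖ), fun h => hs.val_le_of_lt_one hϖ h⟩

/-- Representatives of `𝔭_F ^ m / 𝔭_F ^ (m + 1)`. -/
def stepRep (ϖ : 𝒪[F]) (m : ℤ) (a : 𝓀[F]) : F := (ϖ : F) ^ m * lift F a

theorem isLatticeSystem_stepRep (hs : IsUnitSqrt σ s) (hϖ : Irreducible ϖ) (m : ℤ) :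
    IsLatticeSystem E ϖ (stepRep ϖ m) m (m + 1) := by
  have h0 : (ϖ : F) ≠ 0 := fun h => hϖ.ne_zero (Subtype.ext h)
  refine ⟨fun a => ?_, fun y hy => ?_⟩
  · rw [stepRep, map_mul, map_zpow₀]
    refine (unif_zpow_mul_mem_iff hϖ m).2 ?_
    rw [sub_self]
    exact integer_mem hϖ _
  · obtain ⟨z, rfl⟩ : ∃ z, y = (ϖ : F) ^ m * z :=
      ⟨(ϖ : F) ^ (-m) * y, by rw [zpow_neg, mul_inv_cancel_left₀ (zpow_ne_zero _ h0)]⟩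
    rw [map_mul, map_zpow₀] at hy
    have hz := (unif_zpow_mul_mem_iff hϖ m).1 hy
    rw [sub_self, mem_primePow hϖ, zpow_zero, valuation_algebraMap_le_one_iff] at hz
    have key : ∀ a : 𝓀[F], algebraMap F E ((ϖ : F) ^ m * z - (ϖ : F) ^ m * lift F a) ∈
        primePow ϖ (m + 1) ↔ IsLocalRing.residue 𝒪[F] ⟨z, hz⟩ = a := by
      intro a
      rw [← mul_sub, map_mul, map_zpow₀]
      refine (unif_zpow_mul_mem_iff hϖ m).trans ?_
      rw [add_sub_cancel_left]
      refine (sub_mem_iff_residue_eq hs hϖ (⟨z, hz⟩ : 𝒪[F]) (lift F a)).trans ?_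
      rw [residue_lift]
    simp only [stepRep, key]
    exact ⟨_, rfl, fun _ h => h.symm⟩

/-- Representatives of `𝔭_F ^ m / 𝔭_F ^ (m + 2)`. -/
def twoStepRep (ϖ : 𝒪[F]) (m : ℤ) (a : 𝓀[F] × 𝓀[F]) : F :=
  stepRep ϖ m a.1 + stepRep ϖ (m + 1) a.2

theorem isLatticeSystem_twoStepRep (hs : IsUnitSqrt σ s) (hϖ : Irreducible ϖ) (m : ℤ) :
    IsLatticeSystem E ϖ (twoStepRep ϖ m) m (m + 1 + 1) :=
  IsLatticeSystem.add hϖ (by omega) (by omega) (isLatticeSystem_stepRep hs hϖ m)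
    (isLatticeSystem_stepRep hs hϖ (m + 1))

/-- Representatives of `𝔬_E / 𝔭_E` in the coordinates given by `s`. -/
def resRep (s : E) (i : 𝓀[F] × 𝓀[F]) : E :=
  algebraMap F E (lift F i.1 : F) + algebraMap F E (lift F i.2 : F) * s

theorem isResidueSystem_resRep (hs : IsUnitSqrt σ s) (hϖ : Irreducible ϖ) :
    IsResidueSystem ϖ (resRep (F := F) s) := by
  have h1 := isLatticeSystem_stepRep hs hϖ 0
  simp only [IsLatticeSystem, stepRep, zpow_zero, one_mul, zero_add] at h1
  refine ⟨fun i => (hs.mem_iff hϖ _ _).2 ⟨h1.1 _, h1.1 _⟩, fun x hx => ?_⟩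
  obtain ⟨a, b, rfl⟩ := hs.span x
  rw [hs.mem_iff hϖ] at hx
  have key : ∀ i, algebraMap F E a + algebraMap F E b * s - resRep s i ∈ primePow ϖ 1 ↔
      algebraMap F E (a - lift F i.1) ∈ primePow ϖ 1 ∧
      algebraMap F E (b - lift F i.2) ∈ primePow ϖ 1 := by
    intro i
    rw [← hs.mem_iff hϖ, resRep]
    simp only [map_sub]
    ring_nf
  obtain ⟨i, hi, hi'⟩ := h1.2 a hx.1
  obtain ⟨j, hj, hj'⟩ := h1.2 b hx.2
  refine ⟨(i, j), (key _).2 ⟨hi, hj⟩, fun p hp => ?_⟩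
  exact Prod.ext (hi' _ ((key p).1 hp).1) (hj' _ ((key p).1 hp).2)

/-- A nontrivial character of `𝔭_E ^ (-1) / 𝔬_E` sums to zero over representatives. -/
theorem sum_char_resRep (hs : IsUnitSqrt σ s) (hϖ : Irreducible ϖ) [Fintype 𝓀[F]]
    {ψ : AddChar E ℂ} (hψ : HasConductorIntegers ϖ ψ) :
    ∑ i : 𝓀[F] × 𝓀[F], ψ ((unif E ϖ)⁻¹ * resRep s i) = 0 := by
  have hX := isResidueSystem_resRep hs hϖ
  have h0 := unif_ne_zero (E := E) hϖ
  obtain ⟨x, hx, hne⟩ := hψ.2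
  have hx0 : unif E ϖ * x ∈ primePow ϖ 0 := by
    have := unif_zpow_mul_mem_iff (x := x) (n := 0) hϖ 1
    rw [zpow_one] at this
    exact this.2 (by simpa using hx)
  choose e he he' using fun i => hX.2 _ (add_mem_primePow hϖ hx0 (hX.1 i))
  have hinj : Function.Injective e := by
    intro i j hij
    have h1 := sub_mem_primePow hϖ (he i) (hij ▸ he j)
    refine (hX.2 _ (hX.1 i)).unique (by simpa using zero_mem_primePow) ?_
    convert h1 using 1
    ring
  have hψe : ∀ i, ψ ((unif E ϖ)⁻¹ * resRep s (e i)) = ψ x * ψ ((unif E ϖ)⁻¹ * resRep s i) := by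
    intro i
    have h1 : ψ ((unif E ϖ)⁻¹ * (unif E ϖ * x + resRep s i - resRep s (e i))) = 1 := by
      have := (unif_zpow_mul_mem_iff (n := 0) hϖ (-1)).2 (he i)
      rw [zpow_neg_one, primePow_zero hϖ] at this
      exact hψ.1 ⟨_, this⟩
    have h2 : x + (unif E ϖ)⁻¹ * resRep s i =
        (unif E ϖ)⁻¹ * (unif E ϖ * x + resRep s i - resRep s (e i)) +
          (unif E ϖ)⁻¹ * resRep s (e i) := by
      field_simp
      ring
    rw [← AddChar.map_add_eq_mul, h2, AddChar.map_add_eq_mul, h1, one_mul]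
  have hsum := Equiv.sum_comp (Equiv.ofBijective e (Finite.injective_iff_bijective.1 hinj))
    (fun i => ψ ((unif E ϖ)⁻¹ * resRep s i))
  simp only [Equiv.ofBijective_apply, hψe, ← Finset.mul_sum] at hsum
  have : (ψ x - 1) * ∑ i : 𝓀[F] × 𝓀[F], ψ ((unif E ϖ)⁻¹ * resRep s i) = 0 := by
    linear_combination hsum
  exact (mul_eq_zero.1 this).resolve_left (sub_ne_zero.2 hne)

end Representatives

/-! ### Elements of the unitary group -/

section Elements

variable {F E : Type*} [Field F] [Field E] [Algebra F E] {σ : E ≃ₐ[F] E}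

theorem mat_mul (g h : G σ) : mat (g * h) = mat g * mat h := rfl

theorem mat_one : mat (1 : G σ) = 1 := rfl

theorem mat_injective : Function.Injective (mat : G σ → Matrix (Fin 3) (Fin 3) E) :=
  fun _ _ h => Subtype.ext (Units.ext h)

theorem J_mul_J : J E * J E = 1 := by
  ext i j
  fin_cases i <;> fin_cases j <;> simp [J, Matrix.mul_apply, Fin.sum_univ_three]

theorem J_mul_mul_J_apply (M : Matrix (Fin 3) (Fin 3) E) (i j : Fin 3) :
    (J E * M * J E) i j = M i.rev j.rev := by
  fin_cases i <;> fin_cases j <;>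
    simp [J, Matrix.mul_apply, Fin.sum_univ_three, Fin.rev, Matrix.vecMul, dotProduct]

theorem adjoint_mul_of_isometry {M : Matrix (Fin 3) (Fin 3) E}
    (hM : (M.map σ).transpose * J E * M = J E) :
    (J E * (M.map σ).transpose * J E) * M = 1 := by
  calc _ = J E * ((M.map σ).transpose * J E * M) := by simp only [Matrix.mul_assoc]
    _ = 1 := by rw [hM, J_mul_J]

/-- The element of `G` with a given matrix. -/
def ofMatrix (M : Matrix (Fin 3) (Fin 3) E) (hM : (M.map σ).transpose * J E * M = J E) : G σ :=
  ⟨⟨M, J E * (M.map σ).transpose * J E,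
    mul_eq_one_comm.1 (adjoint_mul_of_isometry hM), adjoint_mul_of_isometry hM⟩, hM⟩

@[simp]
theorem mat_ofMatrix (M : Matrix (Fin 3) (Fin 3) E) (hM : (M.map σ).transpose * J E * M = J E) :
    mat (ofMatrix M hM) = M := rfl

/-- The inverse of an element of `G` is its conjugate reflected in the antidiagonal. -/
theorem mat_inv_apply (g : G σ) (i j : Fin 3) : mat g⁻¹ i j = σ (mat g j.rev i.rev) := by
  have h1 : (J E * ((mat g).map σ).transpose * J E) * mat g = 1 :=
    adjoint_mul_of_isometry g.2
  have h2 : mat g * mat g⁻¹ = 1 := by rw [← mat_mul, mul_inv_cancel, mat_one]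
  have h3 : mat g⁻¹ = J E * ((mat g).map σ).transpose * J E := by
    calc mat g⁻¹ = (J E * ((mat g).map σ).transpose * J E * mat g) * mat g⁻¹ := by
          rw [h1, one_mul]
      _ = _ := by rw [Matrix.mul_assoc, h2, mul_one]
  rw [h3, J_mul_mul_J_apply]
  rfl

theorem mat_mul_apply (g h : G σ) (i j : Fin 3) :
    mat (g * h) i j = mat g i 0 * mat h 0 j + mat g i 1 * mat h 1 j + mat g i 2 * mat h 2 j := by
  rw [mat_mul, Matrix.mul_apply, Fin.sum_univ_three]

/-- The hermitian relations between the columns `i` and `j` of an element of `G`. -/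
theorem column_relation (g : G σ) (i j : Fin 3) :
    σ (mat g 2 i) * mat g 0 j + σ (mat g 1 i) * mat g 1 j + σ (mat g 0 i) * mat g 2 j =
      (1 : Matrix (Fin 3) (Fin 3) E) i.rev j := by
  have := mat_mul_apply g⁻¹ g i.rev j
  rw [inv_mul_cancel, mat_one] at this
  rw [this]
  simp only [mat_inv_apply, Fin.rev_rev]
  rfl

/-- The exponents of `ζ`. -/
def wt : Fin 3 → ℤ := ![1, 0, -1]

theorem mat_zeta (ϖ : F) (hϖ : ϖ ≠ 0) :
    mat (zeta σ ϖ hϖ) = Matrix.diagonal fun j => algebraMap F E ϖ ^ wt j := by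
  change Matrix.diagonal ![algebraMap F E ϖ, 1, (algebraMap F E ϖ)⁻¹] = _
  congr 1; ext j; fin_cases j <;> simp [wt]

theorem mat_zeta_inv (ϖ : F) (hϖ : ϖ ≠ 0) :
    mat (zeta σ ϖ hϖ)⁻¹ = Matrix.diagonal fun j => algebraMap F E ϖ ^ (-wt j) := by
  change Matrix.diagonal ![(algebraMap F E ϖ)⁻¹, 1, algebraMap F E ϖ] = _
  congr 1; ext j; fin_cases j <;> simp [wt]

theorem mat_zeta_zpow (ϖ : F) (hϖ : ϖ ≠ 0) (i : ℤ) :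
    mat (zeta σ ϖ hϖ ^ i) = Matrix.diagonal fun j => algebraMap F E ϖ ^ (i * wt j) := by
  have h : algebraMap F E ϖ ≠ 0 := (map_ne_zero _).2 hϖ
  induction i using Int.induction_on with
  | zero => simp [mat_one]
  | succ i ih =>
    rw [zpow_add_one, mat_mul, ih, mat_zeta, Matrix.diagonal_mul_diagonal]
    congr 1; ext j; rw [← zpow_add₀ h]; ring_nf
  | pred i ih =>
    rw [zpow_sub_one, mat_mul, ih, mat_zeta_inv, Matrix.diagonal_mul_diagonal]
    congr 1; ext j; rw [← zpow_add₀ h]; ring_nf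

theorem mat_zeta_conj (ϖ : F) (hϖ : ϖ ≠ 0) (g : G σ) (i j : Fin 3) :
    mat ((zeta σ ϖ hϖ)⁻¹ * g * zeta σ ϖ hϖ) i j =
      algebraMap F E ϖ ^ (wt j - wt i) * mat g i j := by
  have h : algebraMap F E ϖ ≠ 0 := (map_ne_zero _).2 hϖ
  rw [mat_mul, mat_mul, mat_zeta, mat_zeta_inv, Matrix.mul_diagonal, Matrix.diagonal_mul,
    sub_eq_neg_add, zpow_add₀ h]
  ring

/-- The antidiagonal element `t_n`. -/
def weyl (σ : E ≃ₐ[F] E) (ϖ : F) (hϖ : ϖ ≠ 0) (n : ℤ) : G σ :=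
  ofMatrix !![0, 0, algebraMap F E ϖ ^ (-n); 0, 1, 0; algebraMap F E ϖ ^ n, 0, 0] (by
    have h : algebraMap F E ϖ ^ n ≠ 0 := zpow_ne_zero n ((map_ne_zero _).2 hϖ)
    ext i j
    fin_cases i <;> fin_cases j <;>
      simp [J, Matrix.mul_apply, Fin.sum_univ_three, h])

theorem mat_weyl (ϖ : F) (hϖ : ϖ ≠ 0) (n : ℤ) : mat (weyl σ ϖ hϖ n) =
    !![0, 0, algebraMap F E ϖ ^ (-n); 0, 1, 0; algebraMap F E ϖ ^ n, 0, 0] := rfl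

theorem weyl_mul_self (ϖ : F) (hϖ : ϖ ≠ 0) (n : ℤ) : weyl σ ϖ hϖ n * weyl σ ϖ hϖ n = 1 := by
  have h : algebraMap F E ϖ ^ n ≠ 0 := zpow_ne_zero n ((map_ne_zero _).2 hϖ)
  apply mat_injective
  ext i j
  rw [mat_mul_apply, mat_weyl, mat_one]
  fin_cases i <;> fin_cases j <;> simp [h]

theorem weyl_inv (ϖ : F) (hϖ : ϖ ≠ 0) (n : ℤ) : (weyl σ ϖ hϖ n)⁻¹ = weyl σ ϖ hϖ n :=
  inv_eq_of_mul_eq_one_left (weyl_mul_self ϖ hϖ n)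

theorem zeta_mul_weyl (ϖ : F) (hϖ : ϖ ≠ 0) (n : ℤ) :
    zeta σ ϖ hϖ * weyl σ ϖ hϖ (n + 1) = weyl σ ϖ hϖ n := by
  have h : algebraMap F E ϖ ≠ 0 := (map_ne_zero _).2 hϖ
  have h2 : mat (zeta σ ϖ hϖ) =
    Matrix.diagonal ![algebraMap F E ϖ, 1, (algebraMap F E ϖ)⁻¹] := rfl
  apply mat_injective
  ext i j
  rw [mat_mul, h2, Matrix.diagonal_mul, mat_weyl, mat_weyl]
  fin_cases i <;> fin_cases j <;> simp [zpow_add₀ h] <;> field_simp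

end Elements

section Unipotent

variable {F E : Type*} [Field F] [ValuativeRel F] [Field E] [ValuativeRel E] [Algebra F E]
  [ValuativeExtension F E] [CharZero F] {σ : E ≃ₐ[F] E} {s : E}

theorem two_ne_zero_of_charZero (F E : Type*) [Field F] [Field E] [Algebra F E] [CharZero F] :
    (2 : E) ≠ 0 := by
  rw [← map_ofNat (algebraMap F E) 2]
  exact (map_ne_zero _).2 two_ne_zero

/-- The element `u(x, y)` with `y = -x σ(x) / 2 + c s`, where `c ∈ F`: as `s` spans the elements
of trace zero, every element of `U` is of this form. -/
def unip (hs : IsUnitSqrt σ s) (x : E) (c : F) : G σ :=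
  ofMatrix !![1, x, -(x * σ x) / 2 + algebraMap F E c * s; 0, 1, -σ x; 0, 0, 1] (by
    have h2 := two_ne_zero_of_charZero F E
    have h3 : σ 2 = 2 := map_ofNat σ 2
    ext i j
    fin_cases i <;> fin_cases j <;>
      simp [J, Matrix.mul_apply, Fin.sum_univ_three, hs.conj, hs.conj_conj, h3]
    field_simp
    ring)

theorem mat_unip (hs : IsUnitSqrt σ s) (x : E) (c : F) : mat (unip hs x c) =
    !![1, x, -(x * σ x) / 2 + algebraMap F E c * s; 0, 1, -σ x; 0, 0, 1] := rfl

theorem unip_inv_mul_one_two (hs : IsUnitSqrt σ s) (x : E) (c : F) (g : G σ) :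
    mat ((unip hs x c)⁻¹ * g) 1 2 = mat g 1 2 + σ x * mat g 2 2 := by
  rw [mat_mul_apply]
  simp [mat_inv_apply, mat_unip, Fin.rev]

theorem unip_inv_mul_zero_two (hs : IsUnitSqrt σ s) (x : E) (c : F) (g : G σ) :
    mat ((unip hs x c)⁻¹ * g) 0 2 = mat g 0 2 - x * mat g 1 2 +
      (-(x * σ x) / 2 - algebraMap F E c * s) * mat g 2 2 := by
  have h3 : σ 2 = 2 := map_ofNat σ 2
  rw [mat_mul_apply]
  simp [mat_inv_apply, mat_unip, Fin.rev, hs.conj, hs.conj_conj, h3]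
  ring

theorem exists_zeta_zpow_mul_unip (hs : IsUnitSqrt σ s) (ϖ : F) (hϖ : ϖ ≠ 0) (i : ℤ) (x : E)
    (c : F) : ∃ (u : G σ) (y : E), mat u = !![1, algebraMap F E ϖ ^ i * x, y;
      0, 1, -σ (algebraMap F E ϖ ^ i * x); 0, 0, 1] ∧
      zeta σ ϖ hϖ ^ i * unip hs x c = u * zeta σ ϖ hϖ ^ i := by
  have h : algebraMap F E ϖ ^ i ≠ 0 := zpow_ne_zero i ((map_ne_zero _).2 hϖ)
  refine ⟨zeta σ ϖ hϖ ^ i * unip hs x c * (zeta σ ϖ hϖ ^ i)⁻¹,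
    algebraMap F E ϖ ^ i * mat (unip hs x c) 0 2 * algebraMap F E ϖ ^ i, ?_, by group⟩
  have h1 : mat (zeta σ ϖ hϖ ^ i)⁻¹ =
      Matrix.diagonal fun j => algebraMap F E ϖ ^ (-i * wt j) := by
    rw [← zpow_neg, mat_zeta_zpow]
  rw [mat_mul, mat_mul, h1, mat_zeta_zpow, mat_unip]
  ext j k
  rw [Matrix.mul_diagonal, Matrix.diagonal_mul]
  fin_cases j <;> fin_cases k <;> simp [wt, h, mul_comm]

end Unipotent

/-! ### The groups `K_n` -/

section Level

variable {F E : Type*} [Field F] [ValuativeRel F] [TopologicalSpace F]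
  [IsNonarchimedeanLocalField F] [Field E] [ValuativeRel E] [Algebra F E]
  [ValuativeExtension F E] {σ : E ≃ₐ[F] E} {s : E} {ϖ : 𝒪[F]} {n m : ℤ}

/-- The exponents of the lattices in which the entries of the elements of `K_n` lie. -/
def exps (n : ℤ) : Fin 3 → Fin 3 → ℤ := ![![0, 0, -n], ![n, 0, 0], ![n, n, 0]]

/-- The elements with entries as in `K_n`, except that the central entry lies in `1 + 𝔭_E ^ m`. -/
def levelSet (σ : E ≃ₐ[F] E) (ϖ : 𝒪[F]) (n m : ℤ) : Set (G σ) :=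
  {g | (∀ i j, mat g i j ∈ primePow ϖ (exps n i j)) ∧ mat g 1 1 - 1 ∈ primePow ϖ m}

theorem exps_triangle (hn : 0 ≤ n) (i j k : Fin 3) : exps n i k ≤ exps n i j + exps n j k := by
  fin_cases i <;> fin_cases j <;> fin_cases k <;> simp [exps] <;> omega

theorem exps_rev (i j : Fin 3) : exps n j.rev i.rev = exps n i j := by
  fin_cases i <;> fin_cases j <;> rfl

theorem K_eq_levelSet (hϖ : Irreducible ϖ) (n : ℕ) : K σ ϖ n = levelSet σ ϖ n n := by
  have h0 : ∀ x : E, x ∈ 𝒪[E] ↔ x ∈ primePow ϖ 0 := fun x => by rw [primePow_zero hϖ]; rfl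
  ext g
  simp only [K, levelSet, Set.mem_ofPred_eq, h0, Fin.forall_fin_succ, exps]
  constructor
  · rintro ⟨h1, h2, h3, h4, h5, h6, h7, h8, h9⟩
    have h5' : mat g 1 1 ∈ primePow ϖ 0 := by
      have := add_mem_primePow hϖ (primePow_mono hϖ (Int.natCast_nonneg n) h5)
        (one_mem_primePow hϖ)
      rwa [sub_add_cancel] at this
    simp_all
  · rintro ⟨h, h'⟩
    simp_all

/-- `levelSet σ ϖ n m` as a subgroup. -/
def level (hs : IsUnitSqrt σ s) (hϖ : Irreducible ϖ) (hn : 0 ≤ n) (hm : m ≤ n) :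
    Subgroup (G σ) where
  carrier := levelSet σ ϖ n m
  one_mem' := by
    refine ⟨fun i j => ?_, by simpa [mat_one] using zero_mem_primePow⟩
    rw [mat_one]
    have h1 := one_mem_primePow (E := E) hϖ
    have h0 := fun k => zero_mem_primePow (E := E) (ϖ := ϖ) (n := k)
    fin_cases i <;> fin_cases j <;> simp [exps, h0, h1]
  mul_mem' := by
    intro g h hg hh
    have key : ∀ i j k, mat g i j * mat h j k ∈ primePow ϖ (exps n i k) := fun i j k =>
      primePow_mono hϖ (exps_triangle hn i j k) (mul_mem_primePow hϖ (hg.1 i j) (hh.1 j k))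
    refine ⟨fun i k => ?_, ?_⟩
    · rw [mat_mul_apply]
      exact add_mem_primePow hϖ (add_mem_primePow hϖ (key _ _ _) (key _ _ _)) (key _ _ _)
    · have e : mat (g * h) 1 1 - 1 = mat g 1 0 * mat h 0 1 +
          (mat g 1 1 - 1) * mat h 1 1 + (mat h 1 1 - 1) + mat g 1 2 * mat h 2 1 := by
        rw [mat_mul_apply]; ring
      rw [e]
      refine add_mem_primePow hϖ (add_mem_primePow hϖ (add_mem_primePow hϖ ?_ ?_) hh.2) ?_
      · exact primePow_mono hϖ (by simpa [exps] using hm)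
          (mul_mem_primePow hϖ (hg.1 1 0) (hh.1 0 1))
      · exact primePow_mono hϖ (by simp [exps]) (mul_mem_primePow hϖ hg.2 (hh.1 1 1))
      · exact primePow_mono hϖ (by simpa [exps] using hm)
          (mul_mem_primePow hϖ (hg.1 1 2) (hh.1 2 1))
  inv_mem' := by
    intro g hg
    refine ⟨fun i j => ?_, ?_⟩
    · rw [mat_inv_apply, hs.conj_mem_iff hϖ, ← exps_rev]
      exact hg.1 _ _
    · rw [mat_inv_apply, ← map_one σ, ← map_sub, hs.conj_mem_iff hϖ]
      exact hg.2

theorem weyl_mem (hϖ : Irreducible ϖ) (hϖ0 : (ϖ : F) ≠ 0) :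
    weyl σ (ϖ : F) hϖ0 n ∈ levelSet σ ϖ n m := by
  have h0 := fun k => zero_mem_primePow (E := E) (ϖ := ϖ) (n := k)
  have h1 := one_mem_primePow (E := E) hϖ
  refine ⟨fun i j => ?_, by simpa [mat_weyl] using h0 m⟩
  rw [mat_weyl]
  have h2 := fun k => unif_zpow_mem (E := E) hϖ k
  have h3 := h2 (-n)
  rw [zpow_neg] at h3
  simp only [unif] at h2 h3
  fin_cases i <;> fin_cases j <;> simp [exps, h0, h1, h2, h3]

variable [CharZero F]

theorem unip_mem (hp : ringChar 𝓀[F] ≠ 2) (hs : IsUnitSqrt σ s) (hϖ : Irreducible ϖ)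
    (hn : 0 ≤ n) {x : E} {c : F}
    (hx : x ∈ primePow ϖ 0) (hc : algebraMap F E c ∈ primePow ϖ (-n)) :
    unip hs x c ∈ levelSet σ ϖ n m := by
  have h0 := fun k => zero_mem_primePow (E := E) (ϖ := ϖ) (n := k)
  have h1 := one_mem_primePow (E := E) hϖ
  have hx' : σ x ∈ primePow ϖ 0 := (hs.conj_mem_iff hϖ).2 hx
  have h2 : -(x * σ x) / 2 + algebraMap F E c * s ∈ primePow ϖ (-n) := by
    refine add_mem_primePow hϖ (primePow_mono hϖ (by omega : -n ≤ 0) ?_)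
      ((hs.mul_s_mem_iff hϖ).2 hc)
    rw [half_mem_iff hp hϖ, neg_mem_primePow_iff hϖ]
    exact mul_mem_primePow hϖ hx hx'
  refine ⟨fun i j => ?_, by simpa [mat_unip] using h0 m⟩
  rw [mat_unip]
  fin_cases i <;> fin_cases j <;> simp [exps, h0, h1, h2, hx, hx', neg_mem_primePow_iff hϖ]

/-! ### Coset representatives -/

/-- For `g ∈ K_n` with `n ≥ 1`, the upper and lower entries of the last column of `g` do not both
lie in the next smaller lattice: up to scaling, the column is primitive. -/
theorem lower_entry_not_mem (hs : IsUnitSqrt σ s) (hϖ : Irreducible ϖ) (hn : 1 ≤ n) {g : G σ}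
    (hg : g ∈ levelSet σ ϖ n m) (h : mat g 0 2 ∈ primePow ϖ (1 - n)) :
    mat g 2 2 ∉ primePow ϖ 1 := by
  intro h22
  have h1 := column_relation g 0 2
  have a1 := mul_mem_primePow hϖ ((hs.conj_mem_iff hϖ).2 (hg.1 2 0)) h
  have a2 := mul_mem_primePow hϖ ((hs.conj_mem_iff hϖ).2 (hg.1 1 0)) (hg.1 1 2)
  have a3 := mul_mem_primePow hϖ ((hs.conj_mem_iff hϖ).2 (hg.1 0 0)) h22
  simp only [exps] at a1 a2 a3
  have a4 := add_mem_primePow hϖ (add_mem_primePow hϖ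
    (primePow_mono hϖ (m := 1) (by simp) a1) (primePow_mono hϖ (m := 1) (by simpa using hn) a2))
    (primePow_mono hϖ (m := 1) (by simp) a3)
  have e0 : (1 : Matrix (Fin 3) (Fin 3) E) (Fin.rev 0) 2 = 1 := by
    rw [show Fin.rev (0 : Fin 3) = 2 from rfl, Matrix.one_apply_eq]
  rw [h1, e0] at a4
  rw [mem_primePow hϖ, map_one, zpow_one] at a4
  exact absurd a4 (not_le.2 (val_unif_lt_one hϖ))

/-- `ζ⁻¹ g ζ ∈ levelSet σ ϖ n' n`, for `g ∈ K_n`, is a condition on the last column of `g`. -/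
theorem zeta_conj_mem_iff (hs : IsUnitSqrt σ s) (hϖ : Irreducible ϖ) (hϖ0 : (ϖ : F) ≠ 0)
    (hn : 1 ≤ n) {n' : ℤ} (h1 : n ≤ n') (h2 : n' ≤ n + 1) {g : G σ}
    (hg : g ∈ levelSet σ ϖ n n) :
    (zeta σ (ϖ : F) hϖ0)⁻¹ * g * zeta σ (ϖ : F) hϖ0 ∈ levelSet σ ϖ n' n ↔
      mat g 1 2 ∈ primePow ϖ 1 ∧ mat g 0 2 ∈ primePow ϖ (2 - n') := by
  have e : ∀ i j k, mat ((zeta σ (ϖ : F) hϖ0)⁻¹ * g * zeta σ (ϖ : F) hϖ0) i j ∈ primePow ϖ k ↔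
      mat g i j ∈ primePow ϖ (k - (wt j - wt i)) := fun i j k => by
    rw [mat_zeta_conj]
    exact unif_zpow_mul_mem_iff hϖ _
  constructor
  · intro h
    refine ⟨?_, ?_⟩
    · simpa [wt, exps] using (e 1 2 _).1 (h.1 1 2)
    · convert (e 0 2 _).1 (h.1 0 2) using 2
      simp [wt, exps]; ring
  · rintro ⟨h12, h02⟩
    have h22 := lower_entry_not_mem hs hϖ hn hg (primePow_mono hϖ (by omega) h02)
    have h22' := hs.inv_mem hϖ (hg.1 2 2) h22
    -- orthogonality of the last two columns controls the remaining entry, as `g 2 2` is a unit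
    have h01 : mat g 0 1 ∈ primePow ϖ 1 := by
      rw [← hs.conj_mem_iff hϖ]
      have hr := column_relation g 1 2
      have a1 := mul_mem_primePow hϖ ((hs.conj_mem_iff hϖ).2 (hg.1 2 1)) h02
      have a2 := mul_mem_primePow hϖ ((hs.conj_mem_iff hϖ).2 (hg.1 1 1)) h12
      simp only [exps] at a1 a2
      have a4 := add_mem_primePow hϖ
        (primePow_mono hϖ (m := 1) (by simp; omega) a1)
        (primePow_mono hϖ (m := 1) (by simp) a2)
      have a5 := mul_mem_primePow hϖ ((neg_mem_primePow_iff hϖ).2 a4) h22'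
      have hne : mat g 2 2 ≠ 0 := fun h => h22 (h ▸ zero_mem_primePow)
      have e0 : (1 : Matrix (Fin 3) (Fin 3) E) (Fin.rev 1) 2 = 0 := by
        simp [Fin.rev]
      rw [e0] at hr
      have e1 : σ (mat g 0 1) = -(σ (mat g 2 1) * mat g 0 2 + σ (mat g 1 1) * mat g 1 2) *
          (mat g 2 2)⁻¹ := by
        field_simp
        linear_combination hr
      rw [e1]
      exact primePow_mono hϖ (by simp [exps]) a5
    refine ⟨fun i j => (e i j _).2 ?_, ?_⟩
    · have b00 := hg.1 0 0
      have b10 := hg.1 1 0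
      have b11 := hg.1 1 1
      have b20 := hg.1 2 0
      have b21 := hg.1 2 1
      have b22 := hg.1 2 2
      simp only [exps] at b00 b10 b11 b20 b21 b22
      have h02' : mat g 0 2 ∈ primePow ϖ (-n' + 2) := by rwa [neg_add_eq_sub]
      fin_cases i <;> fin_cases j <;> simp [wt, exps]
      all_goals first
        | assumption
        | exact primePow_mono hϖ (by simp; omega) b10
        | exact primePow_mono hϖ (by simp; omega) b20
        | exact primePow_mono hϖ (by simp; omega) b21
    · rw [mat_zeta_conj]
      simpa [wt] using hg.2

variable {ι I₁ I₂ : Type*}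

theorem existsUnique_unip (hp : ringChar 𝓀[F] ≠ 2) (hs : IsUnitSqrt σ s) (hϖ : Irreducible ϖ)
    {X : ι → E} (hX : IsResidueSystem ϖ X) {c : I₁ → F} {k : ℤ}
    (hm : m ≤ 0) (hk : k ≤ 0) (hc : IsLatticeSystem E ϖ c m k)
    {g : G σ} (h02 : mat g 0 2 ∈ primePow ϖ m) (h12 : mat g 1 2 ∈ primePow ϖ 0)
    (h22 : mat g 2 2 ∈ primePow ϖ 0) (h22' : mat g 2 2 ∉ primePow ϖ 1) :
    ∃! p : ι × I₁, mat ((unip hs (X p.1) (c p.2))⁻¹ * g) 1 2 ∈ primePow ϖ 1 ∧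
      mat ((unip hs (X p.1) (c p.2))⁻¹ * g) 0 2 ∈ primePow ϖ k := by
  have h2 := two_ne_zero_of_charZero F E
  have hinv : (mat g 2 2)⁻¹ ∈ primePow ϖ 0 := by simpa using hs.inv_mem hϖ h22 h22'
  have hne : mat g 2 2 ≠ 0 := fun h => h22' (h ▸ zero_mem_primePow)
  have hunit : ∀ (k : ℤ) (z : E), z * mat g 2 2 ∈ primePow ϖ k ↔ z ∈ primePow ϖ k := by
    intro k z
    constructor
    · intro h
      have := mul_mem_primePow hϖ h hinv
      rwa [mul_inv_cancel_right₀ hne, add_zero] at this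
    · intro h
      simpa using mul_mem_primePow hϖ h h22
  obtain ⟨x, hx⟩ : ∃ x, mat g 1 2 = -σ x * mat g 2 2 :=
    ⟨-σ (mat g 1 2 / mat g 2 2), by
      rw [map_neg, hs.conj_conj, neg_neg, div_mul_cancel₀ _ hne]⟩
  obtain ⟨y, hy⟩ : ∃ y, mat g 0 2 = y * mat g 2 2 :=
    ⟨mat g 0 2 / mat g 2 2, by rw [div_mul_cancel₀ _ hne]⟩
  have hx0 : x ∈ primePow ϖ 0 := by
    rwa [hx, hunit, neg_mem_primePow_iff hϖ, hs.conj_mem_iff hϖ] at h12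
  have hy0 : y ∈ primePow ϖ m := by rwa [hy, hunit] at h02
  -- the last column is isotropic, so the element `u(x, y)` with the same last column lies in `U`
  have hrel : y + σ y + x * σ x = 0 := by
    have hr := column_relation g 2 2
    have e0 : (1 : Matrix (Fin 3) (Fin 3) E) (Fin.rev 2) 2 = 0 := by simp [Fin.rev]
    rw [e0, hx, hy, map_mul, map_mul, map_neg, hs.conj_conj] at hr
    have hne' : σ (mat g 2 2) ≠ 0 := (map_ne_zero _).2 hne
    have : (y + σ y + x * σ x) * (σ (mat g 2 2) * mat g 2 2) = 0 := by linear_combination hr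
    exact (mul_eq_zero.1 this).resolve_right (mul_ne_zero hne' hne)
  obtain ⟨a, b, hab⟩ := hs.span y
  have hyb : y = -(x * σ x) / 2 + algebraMap F E b * s := by
    have : σ y = algebraMap F E a - algebraMap F E b * s := by
      rw [hab, map_add, map_mul, hs.conj, AlgEquiv.commutes, AlgEquiv.commutes]; ring
    rw [this] at hrel
    field_simp
    linear_combination hrel + hab
  have hhalf : ∀ z w : E, z ∈ primePow ϖ 0 → w ∈ primePow ϖ 0 →
      -(z * σ w) / 2 ∈ primePow (E := E) ϖ 0 := by
    intro z w hz hw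
    rw [half_mem_iff hp hϖ, neg_mem_primePow_iff hϖ]
    exact mul_mem_primePow hϖ hz ((hs.conj_mem_iff hϖ).2 hw)
  have hb : algebraMap F E b ∈ primePow ϖ m := by
    rw [← hs.mul_s_mem_iff hϖ]
    have := sub_mem_primePow hϖ hy0 (primePow_mono hϖ hm (hhalf x x hx0 hx0))
    rwa [hyb, add_sub_cancel_left] at this
  have key : ∀ p : ι × I₁, (mat ((unip hs (X p.1) (c p.2))⁻¹ * g) 1 2 ∈ primePow ϖ 1 ∧
      mat ((unip hs (X p.1) (c p.2))⁻¹ * g) 0 2 ∈ primePow ϖ k) ↔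
      (x - X p.1 ∈ primePow ϖ 1 ∧ algebraMap F E (b - c p.2) ∈ primePow ϖ k) := by
    rintro ⟨i, j⟩
    simp only
    refine and_congr ?_ ?_
    · have e : mat ((unip hs (X i) (c j))⁻¹ * g) 1 2 = -σ (x - X i) * mat g 2 2 := by
        rw [unip_inv_mul_one_two, hx, map_sub]; ring
      rw [e, hunit, neg_mem_primePow_iff hϖ, hs.conj_mem_iff hϖ]
    · have e : mat ((unip hs (X i) (c j))⁻¹ * g) 0 2 =
          (algebraMap F E (b - c j) * s +
            (-(x * σ x) / 2 + -(X i * σ (X i)) / 2 + X i * σ x)) * mat g 2 2 := by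
        rw [unip_inv_mul_zero_two, hx, hy, hyb, map_sub]; ring
      have hz : -(x * σ x) / 2 + -(X i * σ (X i)) / 2 + X i * σ x ∈ primePow (E := E) ϖ k := by
        refine primePow_mono hϖ hk (add_mem_primePow hϖ (add_mem_primePow hϖ
          (hhalf _ _ hx0 hx0) (hhalf _ _ (hX.1 i) (hX.1 i))) ?_)
        exact mul_mem_primePow hϖ (hX.1 i) ((hs.conj_mem_iff hϖ).2 hx0)
      rw [e, hunit, ← hs.mul_s_mem_iff (x := algebraMap F E (b - c j)) hϖ]
      refine ⟨fun h => ?_, fun h => add_mem_primePow hϖ h hz⟩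
      have := sub_mem_primePow hϖ h hz
      rwa [add_sub_cancel_right] at this
  obtain ⟨i, hi, hi'⟩ := hX.2 x hx0
  obtain ⟨j, hj, hj'⟩ := hc.2 b hb
  refine ⟨(i, j), (key _).2 ⟨hi, hj⟩, fun p hp' => ?_⟩
  exact Prod.ext (hi' _ ((key p).1 hp').1) (hj' _ ((key p).1 hp').2)

/-- Representatives of the left cosets in `K_n` of `K_n ∩ ζ L ζ⁻¹`, for the groups
`L = levelSet σ ϖ n' n`, `n' ∈ {n, n + 1}`, in the two Bruhat cells. -/
def cosetRep (hs : IsUnitSqrt σ s) (hϖ0 : (ϖ : F) ≠ 0) (n : ℤ) (X : ι → E) (c₁ : I₁ → F)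
    (c₂ : I₂ → F) : (ι × I₁) ⊕ (ι × I₂) → G σ :=
  Sum.elim (fun p => unip hs (X p.1) (c₁ p.2))
    (fun p => weyl σ (ϖ : F) hϖ0 n * unip hs (X p.1) (c₂ p.2))

variable {X : ι → E} {c₁ : I₁ → F} {c₂ : I₂ → F}

theorem cosetRep_mem (hp : ringChar 𝓀[F] ≠ 2) (hs : IsUnitSqrt σ s) (hϖ : Irreducible ϖ)
    (hϖ0 : (ϖ : F) ≠ 0) (hn : 1 ≤ n) {k : ℤ}
    (hX : IsResidueSystem ϖ X) (hc₁ : IsLatticeSystem E ϖ c₁ (-n) k)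
    (hc₂ : IsLatticeSystem E ϖ c₂ (1 - n) k) (r : (ι × I₁) ⊕ (ι × I₂)) :
    cosetRep hs hϖ0 n X c₁ c₂ r ∈ levelSet σ ϖ n n := by
  have hn0 : 0 ≤ n := by omega
  rcases r with ⟨i, j⟩ | ⟨i, j⟩
  · exact unip_mem hp hs hϖ hn0 (hX.1 i) (hc₁.1 j)
  · exact (level hs hϖ hn0 le_rfl).mul_mem (weyl_mem hϖ hϖ0)
      (unip_mem hp hs hϖ hn0 (hX.1 i) (primePow_mono hϖ (by omega) (hc₂.1 j)))

theorem existsUnique_cosetRep (hp : ringChar 𝓀[F] ≠ 2) (hs : IsUnitSqrt σ s) (hϖ : Irreducible ϖ)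
    (hϖ0 : (ϖ : F) ≠ 0) (hn : 1 ≤ n) {n' : ℤ} (h1 : n ≤ n') (h2 : n' ≤ n + 1) (h3 : 2 ≤ n')
    (hX : IsResidueSystem ϖ X) (hc₁ : IsLatticeSystem E ϖ c₁ (-n) (2 - n'))
    (hc₂ : IsLatticeSystem E ϖ c₂ (1 - n) (2 - n')) {g : G σ} (hg : g ∈ levelSet σ ϖ n n) :
    ∃! r, (zeta σ (ϖ : F) hϖ0)⁻¹ * ((cosetRep hs hϖ0 n X c₁ c₂ r)⁻¹ * g) *
      zeta σ (ϖ : F) hϖ0 ∈ levelSet σ ϖ n' n := by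
  have hn0 : 0 ≤ n := by omega
  have h0 := unif_ne_zero (E := E) hϖ
  let L := level hs hϖ hn0 (le_refl n)
  have hcrit : ∀ r, ((zeta σ (ϖ : F) hϖ0)⁻¹ * ((cosetRep hs hϖ0 n X c₁ c₂ r)⁻¹ * g) *
      zeta σ (ϖ : F) hϖ0 ∈ levelSet σ ϖ n' n) ↔
      (mat ((cosetRep hs hϖ0 n X c₁ c₂ r)⁻¹ * g) 1 2 ∈ primePow ϖ 1 ∧
        mat ((cosetRep hs hϖ0 n X c₁ c₂ r)⁻¹ * g) 0 2 ∈ primePow ϖ (2 - n')) := fun r =>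
    zeta_conj_mem_iff hs hϖ hϖ0 hn h1 h2
      (L.mul_mem (L.inv_mem (cosetRep_mem hp hs hϖ hϖ0 hn hX hc₁ hc₂ r)) hg)
  simp only [hcrit]
  set g' : G σ := weyl σ (ϖ : F) hϖ0 n * g with hg'
  have hg'mem : g' ∈ levelSet σ ϖ n n := L.mul_mem (weyl_mem hϖ hϖ0) hg
  have hinr : ∀ p : ι × I₂, (cosetRep hs hϖ0 n X c₁ c₂ (Sum.inr p))⁻¹ * g =
      (unip hs (X p.1) (c₂ p.2))⁻¹ * g' := by
    intro p
    simp [cosetRep, hg', weyl_inv, mul_assoc]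
  have hinl : ∀ p : ι × I₁, (cosetRep hs hϖ0 n X c₁ c₂ (Sum.inl p))⁻¹ * g =
      (unip hs (X p.1) (c₁ p.2))⁻¹ * g := fun p => rfl
  have g'02 : mat g' 0 2 = unif E ϖ ^ (-n) * mat g 2 2 := by
    rw [hg', mat_mul_apply, mat_weyl]; simp [unif]
  have g'22 : mat g' 2 2 = unif E ϖ ^ n * mat g 0 2 := by
    rw [hg', mat_mul_apply, mat_weyl]; simp [unif]
  -- the upper right entry of `u(x, y)⁻¹ g` lies in `𝔭 ^ (1 - n)` only if that of `g` does
  have hcross : ∀ (x : E) (c : F) (h : G σ), x ∈ primePow ϖ 0 → mat h 1 2 ∈ primePow ϖ 0 →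
      algebraMap F E c * mat h 2 2 ∈ primePow ϖ (1 - n) → mat h 2 2 ∈ primePow ϖ 0 →
      mat ((unip hs x c)⁻¹ * h) 0 2 ∈ primePow ϖ (2 - n') → mat h 0 2 ∈ primePow ϖ (1 - n) := by
    intro x c h hx h12 hc h22 hu
    rw [unip_inv_mul_zero_two] at hu
    have a1 := primePow_mono hϖ (m := 1 - n) (by omega) (mul_mem_primePow hϖ hx h12)
    have a2 := primePow_mono hϖ (m := 1 - n) (by omega)
      (mul_mem_primePow hϖ ((half_mem_iff hp hϖ).2 ((neg_mem_primePow_iff hϖ).2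
      (mul_mem_primePow hϖ hx ((hs.conj_mem_iff hϖ).2 hx)))) h22)
    have a3 := (hs.mul_s_mem_iff hϖ).2 hc
    have a4 := primePow_mono hϖ (m := 1 - n) (by omega) hu
    have := sub_mem_primePow hϖ (add_mem_primePow hϖ (add_mem_primePow hϖ a4 a1) a3) a2
    convert this using 1
    ring
  by_cases h22 : mat g 2 2 ∈ primePow ϖ 1
  · have h02 : mat g 0 2 ∉ primePow ϖ (1 - n) := fun h => lower_entry_not_mem hs hϖ hn hg h h22
    have g'22' : mat g' 2 2 ∉ primePow ϖ 1 := by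
      rwa [g'22, unif_zpow_mul_mem_iff hϖ]
    have g'02' : mat g' 0 2 ∈ primePow ϖ (1 - n) := by
      rw [g'02, unif_zpow_mul_mem_iff hϖ]
      simpa using h22
    obtain ⟨p, hp', hpu⟩ := existsUnique_unip hp hs hϖ hX (by omega) (by omega) hc₂
      g'02' (hg'mem.1 1 2) (hg'mem.1 2 2) g'22'
    refine ⟨Sum.inr p, by simpa only [hinr] using hp', ?_⟩
    rintro (r | r) hr
    · simp only [hinl] at hr
      refine absurd (hcross _ _ _ (hX.1 _) (hg.1 1 2) ?_ (hg.1 2 2) hr.2) h02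
      have := mul_mem_primePow hϖ (hc₁.1 r.2) h22
      rwa [neg_add_eq_sub] at this
    · simp only [hinr] at hr
      rw [hpu r hr]
  · obtain ⟨p, hp', hpu⟩ := existsUnique_unip hp hs hϖ hX (by omega) (by omega) hc₁
      (hg.1 0 2) (hg.1 1 2) (hg.1 2 2) h22
    refine ⟨Sum.inl p, by simpa only [hinl] using hp', ?_⟩
    rintro (r | r) hr
    · simp only [hinl] at hr
      rw [hpu r hr]
    · simp only [hinr] at hr
      have h02 := hcross _ _ _ (hX.1 _) (hg'mem.1 1 2)
        (by simpa [exps] using mul_mem_primePow hϖ (hc₂.1 r.2) (hg'mem.1 2 2)) (hg'mem.1 2 2) hr.2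
      rw [g'02, unif_zpow_mul_mem_iff hϖ] at h02
      exact absurd (by simpa using h02) h22

end Level

/-! ### The topology of `K_n` -/

section Topology

open ValuativeRel Topology

variable {F E : Type*} [Field F] [ValuativeRel F] [TopologicalSpace F]
  [IsNonarchimedeanLocalField F] [Field E] [ValuativeRel E] [TopologicalSpace E]
  [IsNonarchimedeanLocalField E] [Algebra F E]
  [ValuativeExtension F E] {σ : E ≃ₐ[F] E} {s : E} {ϖ : 𝒪[F]} {n m : ℤ}

theorem t2Space_of_isNonarchimedeanLocalField (E : Type*) [Field E] [ValuativeRel E]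
    [TopologicalSpace E] [IsNonarchimedeanLocalField E] : T2Space E := by
  let := IsTopologicalAddGroup.rightUniformSpace E
  have := isUniformAddGroup_of_addCommGroup (G := E)
  have : T0Space E := inferInstance
  infer_instance

theorem primePow_eq_preimage (hϖ : Irreducible ϖ) (n : ℤ) :
    (primePow ϖ n : Set E) = (fun x => unif E ϖ ^ (-n) * x) ⁻¹' (𝒪[E] : Set E) := by
  ext x
  rw [Set.mem_preimage, ← primePow_zero hϖ, unif_zpow_mul_mem_iff hϖ, zero_sub, neg_neg]

theorem isClopen_primePow (hϖ : Irreducible ϖ) (n : ℤ) : IsClopen (primePow ϖ n : Set E) := by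
  rw [primePow_eq_preimage hϖ]
  exact (Valuation.isClopen_integer).preimage (by fun_prop)

theorem isCompact_primePow (ϖ : 𝒪[F]) (n : ℤ) : IsCompact (primePow ϖ n : Set E) := by
  have : (primePow ϖ n : Set E) = (fun x => unif E ϖ ^ n * x) '' (𝒪[E] : Set E) := by
    ext x
    constructor
    · rintro ⟨y, rfl⟩
      exact ⟨y, y.2, rfl⟩
    · rintro ⟨y, hy, rfl⟩
      exact ⟨⟨y, hy⟩, rfl⟩
  rw [this]
  exact (IsNonarchimedeanLocalField.isCompact_closedBall E 1).image (by fun_prop)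

theorem IsUnitSqrt.continuous_conj (hs : IsUnitSqrt σ s) : Continuous σ := by
  refine continuous_of_continuousAt_zero σ ?_
  rw [ContinuousAt, map_zero, ((IsValuativeTopology.hasBasis_nhds_zero' E).tendsto_iff
    (IsValuativeTopology.hasBasis_nhds_zero' E))]
  exact fun γ hγ => ⟨γ, hγ, fun x hx => by simpa [hs.val_conj] using hx⟩

theorem continuous_mat_apply (i j : Fin 3) : Continuous fun g : G σ => mat g i j :=
  (Units.continuous_val.comp continuous_subtype_val).matrix_elem i j

theorem isClopen_levelSet (hϖ : Irreducible ϖ) (n m : ℤ) : IsClopen (levelSet σ ϖ n m) := by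
  have : levelSet σ ϖ n m = (⋂ i, ⋂ j, (fun g => mat g i j) ⁻¹' primePow ϖ (exps n i j)) ∩
      (fun g => mat g 1 1 - 1) ⁻¹' primePow ϖ m := by
    ext g; simp [levelSet]
  rw [this]
  refine IsClopen.inter (isClopen_iInter_of_finite fun i => isClopen_iInter_of_finite fun j =>
    (isClopen_primePow hϖ _).preimage (continuous_mat_apply i j)) ?_
  exact (isClopen_primePow hϖ _).preimage ((continuous_mat_apply 1 1).sub continuous_const)

theorem IsUnitSqrt.isClosed_G (hs : IsUnitSqrt σ s) :
    IsClosed ((G σ : Subgroup (GL (Fin 3) E)) : Set (GL (Fin 3) E)) := by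
  have := t2Space_of_isNonarchimedeanLocalField E
  have hc := hs.continuous_conj
  have h1 : Continuous fun g : GL (Fin 3) E => (g : Matrix (Fin 3) (Fin 3) E) :=
    Units.continuous_val
  refine isClosed_eq (f := fun g : GL (Fin 3) E =>
    ((g : Matrix (Fin 3) (Fin 3) E).map σ).transpose * J E * (g : Matrix (Fin 3) (Fin 3) E))
    ?_ continuous_const
  exact (((h1.matrix_map hc).matrix_transpose).matrix_mul continuous_const).matrix_mul h1

theorem isCompact_levelSet (hs : IsUnitSqrt σ s) (hϖ : Irreducible ϖ) (hn : 0 ≤ n)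
    (hm : m ≤ n) : IsCompact (levelSet σ ϖ n m) := by
  have := t2Space_of_isNonarchimedeanLocalField E
  let C : Set (Matrix (Fin 3) (Fin 3) E) :=
    Set.univ.pi fun i => Set.univ.pi fun j => primePow ϖ (exps n i j)
  have hC : IsCompact C :=
    isCompact_univ_pi fun i => isCompact_univ_pi fun j => isCompact_primePow ϖ _
  have hmem : ∀ g ∈ levelSet σ ϖ n m, mat g ∈ C := fun g hg i _ j _ => hg.1 i j
  have hemb : IsClosedEmbedding fun g : G σ => Units.embedProduct _ (g : GL (Fin 3) E) :=
    Units.isClosedEmbedding_embedProduct.comp hs.isClosed_G.isClosedEmbedding_subtypeVal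
  refine (hemb.isCompact_preimage
    (hC.prod (hC.image MulOpposite.continuous_op))).of_isClosed_subset
    (isClopen_levelSet hϖ n m).1 ?_
  intro g hg
  exact ⟨hmem g hg, ⟨_, hmem _ ((level hs hϖ hn hm).inv_mem hg), rfl⟩⟩

end Topology

/-! ### Sums over cosets -/

section Cosets

open MeasureTheory

variable {F E : Type*} [Field F] [Field E] [Algebra F E] {σ : E ≃ₐ[F] E}
variable {V : Type*} [AddCommGroup V] [Module ℂ V] (π : Representation ℂ (G σ) V)
variable {ι : Type*} [Fintype ι]

/-- The sum of the translates of a vector over the cosets of `K ∩ z L z⁻¹` in `K` is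
`K`-invariant when the vector is of the form `π(z) v` with `v` fixed by `L`. -/
theorem sum_cosets_invariant (K L : Subgroup (G σ)) (z : G σ) (R : ι → G σ) (hR : ∀ i, R i ∈ K)
    (hK : ∀ g ∈ K, ∃! i, z⁻¹ * ((R i)⁻¹ * g) * z ∈ L) {v : V} (hv : ∀ g ∈ L, π g v = v) :
    ∀ g ∈ K, π g (∑ i, π (R i * z) v) = ∑ i, π (R i * z) v := by
  intro g hg
  choose e he he' using fun i => hK (g * R i) (K.mul_mem hg (hR i))
  have hinj : Function.Injective e := by
    intro i j hij
    have h1 := L.mul_mem (L.inv_mem (he i)) (hij ▸ he j)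
    refine (hK (R j) (hR j)).unique (y₁ := i) (y₂ := j) ?_ (by simp [L.one_mem])
    convert h1 using 1
    group
  have h : ∀ i, π g (π (R i * z) v) = π (R (e i) * z) v := by
    intro i
    conv_rhs => rw [← hv _ (he i)]
    rw [← Module.End.mul_apply, ← map_mul, ← Module.End.mul_apply, ← map_mul]
    congr 2
    group
  rw [map_sum]
  simp only [h]
  exact Equiv.sum_comp (Equiv.ofBijective e (Finite.injective_iff_bijective.1 hinj))
    (fun i => π (R i * z) v)

theorem IsVectorIntegral.vectorIntegral_eq [MeasurableSpace (G σ)] {μ : Measure (G σ)}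
    {S : Set (G σ)} {f : G σ → V} {w : V} (h : IsVectorIntegral μ S f w) :
    vectorIntegral μ S f = w := by
  have hex : ∃ w, IsVectorIntegral μ S f w := ⟨w, h⟩
  rw [vectorIntegral, dif_pos hex, ← sub_eq_zero, ← Module.forall_dual_apply_eq_zero_iff ℂ]
  intro φ
  rw [map_sub, sub_eq_zero, ← (hex.choose_spec φ).2, (h φ).2]

/-- The integral of a vector fixed by a compact open subgroup `K` over the double coset `K z K` is
a sum over the left cosets in it. -/
theorem vectorIntegral_doubleCoset [TopologicalSpace E] [IsTopologicalRing E]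
    [MeasurableSpace (G σ)] [BorelSpace (G σ)]
    (μ : Measure (G σ)) [μ.IsHaarMeasure] (K : Subgroup (G σ)) (hKo : IsOpen (K : Set (G σ)))
    (hKc : IsCompact (K : Set (G σ))) (z : G σ) (R : ι → G σ) (hR : ∀ i, R i ∈ K)
    (hK : ∀ g ∈ K, ∃! i, z⁻¹ * ((R i)⁻¹ * g) * z ∈ K) {v : V} (hv : ∀ g ∈ K, π g v = v) :
    vectorIntegral μ (DoubleCoset.doubleCoset z (K : Set (G σ)) K) (fun k => π k v) =
      (μ.real K : ℂ) • ∑ i, π (R i * z) v := by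
  let A : ι → Set (G σ) := fun i => (fun g => (R i * z)⁻¹ * g) ⁻¹' K
  have hcont : ∀ i, Continuous fun g : G σ => (R i * z)⁻¹ * g := fun i => continuous_const_mul _
  have hA : ∀ i, MeasurableSet (A i) := fun i => (hKo.preimage (hcont i)).measurableSet
  have hμA : ∀ i, μ (A i) = μ K := fun i => measure_preimage_mul μ _ _
  have hD : DoubleCoset.doubleCoset z (K : Set (G σ)) K = ⋃ i, A i := by
    ext g
    rw [DoubleCoset.mem_doubleCoset, Set.mem_iUnion]
    constructor
    · rintro ⟨x, hx, y, hy, rfl⟩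
      obtain ⟨i, hi, -⟩ := hK x hx
      refine ⟨i, ?_⟩
      have := K.mul_mem hi hy
      simp only [A, Set.mem_preimage, SetLike.mem_coe]
      convert this using 1
      group
    · rintro ⟨i, hi⟩
      exact ⟨R i, hR i, (R i * z)⁻¹ * g, hi, by group⟩
  have hdisj : Pairwise (Function.onFun Disjoint A) := by
    intro i j hij
    rw [Function.onFun, Set.disjoint_left]
    intro g hi hj
    refine hij ((hK (R j) (hR j)).unique (y₁ := i) (y₂ := j) ?_ (by simp [K.one_mem]))
    convert K.mul_mem hi (K.inv_mem hj) using 1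
    group
  have hval : ∀ (φ : Module.Dual ℂ V) (i : ι), ∀ g ∈ A i, φ (π (R i * z) v) = φ (π g v) := by
    intro φ i g hg
    have : g = (R i * z) * ((R i * z)⁻¹ * g) := by group
    conv_rhs => rw [this, map_mul π (R i * z), Module.End.mul_apply, hv _ hg]
  have hint : ∀ (φ : Module.Dual ℂ V) (i : ι), IntegrableOn (fun g => φ (π g v)) (A i) μ := by
    intro φ i
    refine IntegrableOn.congr_fun (f := fun _ => φ (π (R i * z) v)) ?_ (hval φ i) (hA i)
    exact integrableOn_const (by rw [hμA]; exact hKc.measure_ne_top)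
  refine IsVectorIntegral.vectorIntegral_eq fun φ => ⟨?_, ?_⟩
  · rw [hD]
    exact integrableOn_finite_iUnion.2 (hint φ)
  · rw [hD, integral_iUnion_fintype hA hdisj (hint φ), map_smul, map_sum, Finset.smul_sum]
    refine Finset.sum_congr rfl fun i _ => ?_
    rw [← setIntegral_congr_fun (hA i) (hval φ i), setIntegral_const, Measure.real, hμA]
    simp [Measure.real]

end Cosets

/-! ### The central character -/

section Center

variable {F E : Type*} [Field F] [ValuativeRel F] [TopologicalSpace F]
  [IsNonarchimedeanLocalField F] [Field E] [ValuativeRel E] [Algebra F E]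
  [ValuativeExtension F E] {σ : E ≃ₐ[F] E} {s : E} {ϖ : 𝒪[F]}
variable {V : Type*} [AddCommGroup V] [Module ℂ V] {π : Representation ℂ (G σ) V}

theorem mem_Zn_of_le (hϖ : Irreducible ϖ) {m n : ℕ} (h : m ≤ n) {g : G σ} (hg : g ∈ Zn σ ϖ n) :
    g ∈ Zn σ ϖ m := by
  obtain ⟨z, hz, h0 | h1⟩ := hg
  · exact ⟨z, hz, Or.inl (by omega)⟩
  · exact ⟨z, hz, Or.inr (primePow_mono hϖ (by exact_mod_cast h) h1)⟩

theorem Zn_subset_levelSet (hϖ : Irreducible ϖ) {n : ℕ} (hn : n ≠ 0) :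
    Zn σ ϖ n ⊆ levelSet σ ϖ n n := by
  rintro g ⟨z, hz, h⟩
  have hz1 := h.resolve_left hn
  have hz0 : z ∈ primePow ϖ 0 := by
    have := add_mem_primePow hϖ (primePow_mono hϖ (Int.natCast_nonneg n) hz1)
      (one_mem_primePow hϖ)
    rwa [sub_add_cancel] at this
  have h0 := fun k => zero_mem_primePow (E := E) (ϖ := ϖ) (n := k)
  refine ⟨fun i j => ?_, by simpa [hz] using hz1⟩
  rw [hz]
  fin_cases i <;> fin_cases j <;> simp [exps, h0, hz0]

theorem mul_comm_of_mem_Zn {n : ℕ} {z : G σ} (hz : z ∈ Zn σ ϖ n) (g : G σ) : z * g = g * z := by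
  obtain ⟨a, ha, -⟩ := hz
  apply mat_injective
  rw [mat_mul, mat_mul, ha]
  exact (Matrix.scalar_commute a (fun _ => Commute.all _ _) _).eq

/-- The central character is trivial on `Z_n` for every `n` from its conductor on. That its
conductor is a minimum over a nonempty set is seen from `Z_N ⊆ K_N`: the vectors fixed by the
central subgroup `Z_N` form a nonzero subrepresentation. -/
theorem apply_eq_one_of_mem_Zn (hϖ : Irreducible ϖ) (hirr : π.IsIrreducible)
    (hN : conductor π ϖ ≠ 0) {n : ℕ} (hn : centralConductor π ϖ ≤ n) {z : G σ}
    (hz : z ∈ Zn σ ϖ n) : π z = 1 := by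
  set N := conductor π ϖ with hNdef
  have hNmem : N ∈ {n | fixedK π ϖ n ≠ ⊥} :=
    Nat.sInf_mem (Nat.nonempty_of_pos_sInf (Nat.pos_of_ne_zero hN))
  let W : Subrepresentation π := ⟨fixedBy π (Zn σ ϖ N), by
    intro g v hv k hk
    rw [← Module.End.mul_apply, ← map_mul, mul_comm_of_mem_Zn hk, map_mul, Module.End.mul_apply,
      hv k hk]⟩
  have hle : fixedK π ϖ N ≤ W.toSubmodule := by
    intro v hv k hk
    refine hv k ?_
    rw [K_eq_levelSet hϖ]
    exact Zn_subset_levelSet hϖ hN hk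
  have hW : W = ⊤ := by
    refine (IsSimpleOrder.eq_bot_or_eq_top W).resolve_left fun h => hNmem ?_
    rw [h] at hle
    exact le_bot_iff.1 hle
  have hne : {n | ∀ z ∈ Zn σ ϖ n, π z = 1}.Nonempty := by
    refine ⟨N, fun z hz => LinearMap.ext fun v => ?_⟩
    have : v ∈ W.toSubmodule := by rw [hW]; trivial
    exact this z hz
  exact Nat.sInf_mem hne z (mem_Zn_of_le hϖ hn hz)

variable [CharZero F]

/-- A vector fixed by `K_N` and by `Z_{N - 1}` is fixed by the larger group in which the central
entry is only required to lie in `1 + 𝔭_E ^ (N - 1)`. Indeed the central entry `1 + β` of an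
element of this group has norm one modulo `𝔭_E ^ N`, so that it agrees modulo `𝔭_E ^ N` with the
Cayley transform `(1 + δ) / (1 - δ)`, of norm one, of the trace zero element
`δ = (β - σ β) / 4`. -/
theorem apply_eq_self_of_mem_levelSet (hp : ringChar 𝓀[F] ≠ 2) (hs : IsUnitSqrt σ s)
    (hϖ : Irreducible ϖ) {n : ℕ} (hn : 1 ≤ n)
    {v : V} (hv : ∀ g ∈ levelSet σ ϖ (n + 1) (n + 1), π g v = v)
    (hz : ∀ z ∈ Zn σ ϖ n, π z = 1) {g : G σ} (hg : g ∈ levelSet σ ϖ (n + 1) n) :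
    π g v = v := by
  have hn' : (1 : ℤ) ≤ n := by exact_mod_cast hn
  have h2 := two_ne_zero_of_charZero F E
  have hσ2 : σ 2 = 2 := map_ofNat σ 2
  obtain ⟨β, hβ⟩ : ∃ β, β = mat g 1 1 - 1 := ⟨_, rfl⟩
  have hβm : β ∈ primePow ϖ (n : ℤ) := hβ ▸ hg.2
  have hσβ : σ β ∈ primePow ϖ (n : ℤ) := (hs.conj_mem_iff hϖ).2 hβm
  obtain ⟨δ, hδ⟩ : ∃ δ, δ = (β - σ β) / 2 / 2 := ⟨_, rfl⟩
  have hδm : δ ∈ primePow ϖ (n : ℤ) := by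
    rw [hδ, half_mem_iff hp hϖ, half_mem_iff hp hϖ]
    exact sub_mem_primePow hϖ hβm hσβ
  have hσδ : σ δ = -δ := by
    rw [hδ, map_div₀, map_div₀, map_sub, hs.conj_conj, hσ2]; ring
  have hδ1 : δ ∈ primePow ϖ 1 := primePow_mono hϖ hn' hδm
  have hone : (1 : E) ∉ primePow ϖ 1 := by
    rw [mem_primePow hϖ, map_one, zpow_one]
    exact not_le.2 (val_unif_lt_one hϖ)
  have hd : (1 - δ)⁻¹ ∈ primePow ϖ 0 := by
    simpa using hs.inv_mem hϖ (n := 0)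
      (sub_mem_primePow hϖ (one_mem_primePow hϖ) (primePow_mono hϖ zero_le_one hδ1))
      (fun h => hone (by simpa using add_mem_primePow hϖ h hδ1))
  have hd0 : 1 - δ ≠ 0 := fun h => hone (by rwa [sub_eq_zero.1 h])
  have hd0' : 1 + δ ≠ 0 := fun h => hone (by
    rw [eq_neg_of_add_eq_zero_left h, neg_mem_primePow_iff hϖ]; exact hδ1)
  obtain ⟨z, hzdef⟩ : ∃ z, z = (1 + δ) * (1 - δ)⁻¹ := ⟨_, rfl⟩
  have hσz : σ z = (1 - δ) * (1 + δ)⁻¹ := by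
    rw [hzdef, map_mul, map_inv₀, map_add, map_sub, map_one, hσδ]; ring
  have hnorm : σ z * z = 1 := by rw [hσz, hzdef]; field_simp
  have hz1 : z - 1 ∈ primePow ϖ (n : ℤ) := by
    have : z - 1 = 2 * (δ * (1 - δ)⁻¹) := by rw [hzdef]; field_simp; ring
    rw [this, two_mul_mem_iff hp hϖ]
    simpa using mul_mem_primePow hϖ hδm hd
  have hσz0 : σ z ∈ primePow ϖ 0 := by
    rw [hs.conj_mem_iff hϖ]
    have := add_mem_primePow hϖ (primePow_mono hϖ (by omega : (0 : ℤ) ≤ n) hz1)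
      (one_mem_primePow hϖ)
    rwa [sub_add_cancel] at this
  let c : G σ := ofMatrix (Matrix.scalar (Fin 3) z) (by
    have e : ((Matrix.scalar (Fin 3) z).map σ).transpose = Matrix.scalar (Fin 3) (σ z) := by
      simp [Matrix.scalar_apply, Matrix.diagonal_map]
    rw [e, Matrix.mul_assoc, (Matrix.scalar_commute z (fun _ => Commute.all _ _) (J E)).symm.eq,
      ← Matrix.mul_assoc, ← map_mul, hnorm, map_one, one_mul])
  have hc : π c = 1 := hz c ⟨z, rfl, Or.inr hz1⟩
  have hentry : ∀ i j, mat (c⁻¹ * g) i j = σ z * mat g i j := by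
    intro i j
    rw [mat_mul_apply]
    simp only [mat_inv_apply, c, mat_ofMatrix]
    fin_cases i <;> simp [Fin.rev, Matrix.diagonal]
  have htr : β + σ β ∈ primePow ϖ ((n : ℤ) + 1) := by
    have hr := column_relation g 1 1
    have e0 : (1 : Matrix (Fin 3) (Fin 3) E) (Fin.rev 1) 1 = 1 := by
      rw [show Fin.rev (1 : Fin 3) = 1 from rfl, Matrix.one_apply_eq]
    have e1 : β + σ β = -(σ (mat g 2 1) * mat g 0 1 + σ (mat g 0 1) * mat g 2 1 + β * σ β) := by
      have e2 : mat g 1 1 = 1 + β := by rw [hβ]; ring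
      rw [e0, e2, map_add, map_one] at hr
      linear_combination hr
    rw [e1, neg_mem_primePow_iff hϖ]
    have a1 := mul_mem_primePow hϖ ((hs.conj_mem_iff hϖ).2 (hg.1 2 1)) (hg.1 0 1)
    have a2 := mul_mem_primePow hϖ ((hs.conj_mem_iff hϖ).2 (hg.1 0 1)) (hg.1 2 1)
    refine add_mem_primePow hϖ (add_mem_primePow hϖ (by simpa [exps] using a1)
      (by simpa [exps] using a2)) ?_
    exact primePow_mono hϖ (by omega) (mul_mem_primePow hϖ hβm hσβ)
  have hk : c⁻¹ * g ∈ levelSet σ ϖ (n + 1) (n + 1) := by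
    refine ⟨fun i j => ?_, ?_⟩
    · rw [hentry]
      simpa using mul_mem_primePow hϖ hσz0 (hg.1 i j)
    · have e : mat (c⁻¹ * g) 1 1 - 1 = σ z * (((β + σ β) / 2 - β * δ) * (1 - δ)⁻¹) := by
        have e1 : (β + σ β) / 2 - β * δ = (1 + β) * (1 - δ) - (1 + δ) := by
          rw [hδ]; field_simp; ring
        rw [hentry, e1, sub_mul, mul_assoc (1 + β), mul_inv_cancel₀ hd0, ← hzdef]
        linear_combination hnorm - σ z * hβ
      have a1 := sub_mem_primePow hϖ ((half_mem_iff hp hϖ).2 htr)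
        (primePow_mono hϖ (by omega : (n : ℤ) + 1 ≤ n + n) (mul_mem_primePow hϖ hβm hδm))
      rw [e]
      simpa using mul_mem_primePow hϖ hσz0 (mul_mem_primePow hϖ a1 hd)
  calc π g v = π (c * (c⁻¹ * g)) v := by rw [mul_inv_cancel_left]
    _ = v := by rw [map_mul, Module.End.mul_apply, hv _ hk, hc, Module.End.one_apply]

end Center

/-! ### Whittaker functions of newforms -/

section Whittaker

variable {F E : Type*} [Field F] [ValuativeRel F] [Field E] [ValuativeRel E] [Algebra F E]
  [ValuativeExtension F E] [CharZero F] {σ : E ≃ₐ[F] E} {s : E}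
variable {V : Type*} [AddCommGroup V] [Module ℂ V] {π : Representation ℂ (G σ) V}

theorem whittaker_zeta_zpow_unip (hs : IsUnitSqrt σ s) {ϖ : F} (hϖ : ϖ ≠ 0) {ψ : AddChar E ℂ}
    {l : Module.Dual ℂ V} (hl : l ∈ whittakerFunctionals π ψ) (v : V) (i : ℤ) (x : E) (c : F) :
    l (π (zeta σ ϖ hϖ ^ i) (π (unip hs x c * zeta σ ϖ hϖ) v)) =
      ψ (algebraMap F E ϖ ^ i * x) * whittaker π l v (zeta σ ϖ hϖ ^ (i + 1)) := by
  obtain ⟨u, y, hu, h⟩ := exists_zeta_zpow_mul_unip hs ϖ hϖ i x c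
  have h1 : zeta σ ϖ hϖ ^ i * (unip hs x c * zeta σ ϖ hϖ) = u * zeta σ ϖ hϖ ^ (i + 1) := by
    rw [← mul_assoc, h, mul_assoc, zpow_add_one]
  rw [← Module.End.mul_apply, ← map_mul, h1, map_mul, Module.End.mul_apply, hl u _ y hu]
  rfl

end Whittaker

section Hecke

variable {F E : Type*} [Field F] [ValuativeRel F] [TopologicalSpace F]
  [IsNonarchimedeanLocalField F] [Field E] [ValuativeRel E] [Algebra F E]
  [ValuativeExtension F E] [CharZero F] {σ : E ≃ₐ[F] E} {s : E} {ϖ : 𝒪[F]}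
variable {V : Type*} [AddCommGroup V] [Module ℂ V] {π : Representation ℂ (G σ) V}
variable [Fintype 𝓀[F]]

/-- The Hecke operator at level `n + 1` in terms of representatives of the two Bruhat cells. -/
theorem heckeT_eq [TopologicalSpace E] [IsNonarchimedeanLocalField E]
    [MeasurableSpace (G σ)] [BorelSpace (G σ)]
    (μ : MeasureTheory.Measure (G σ)) [μ.IsHaarMeasure] (hp : ringChar 𝓀[F] ≠ 2)
    (hs : IsUnitSqrt σ s) (hϖ : Irreducible ϖ) (hϖ0 : (ϖ : F) ≠ 0) {n : ℕ} (hn : 1 ≤ n) {v : V}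
    (hv : v ∈ fixedK π ϖ (n + 1)) :
    heckeT π μ ϖ hϖ0 (n + 1) v =
      ∑ p : (𝓀[F] × 𝓀[F]) × (𝓀[F] × 𝓀[F]),
        π (unip hs (resRep s p.1) (twoStepRep ϖ (-n - 1) p.2) * zeta σ (ϖ : F) hϖ0) v +
      ∑ p : (𝓀[F] × 𝓀[F]) × 𝓀[F],
        π (weyl σ (ϖ : F) hϖ0 (n + 1) * unip hs (resRep s p.1) (stepRep ϖ (-n) p.2) *
          zeta σ (ϖ : F) hϖ0) v := by
  have hn' : (1 : ℤ) ≤ n := by exact_mod_cast hn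
  let K := level hs hϖ (n := n + 1) (by omega) (le_refl ((n : ℤ) + 1))
  have hK : U21.K σ ϖ (n + 1) = (K : Set (G σ)) := by
    rw [K_eq_levelSet hϖ]; push_cast; rfl
  have hX := isResidueSystem_resRep (F := F) hs hϖ
  have hc₁ : IsLatticeSystem E ϖ (twoStepRep ϖ (-n - 1)) (-((n : ℤ) + 1)) (2 - (n + 1)) := by
    have := isLatticeSystem_twoStepRep hs hϖ (-n - 1)
    convert this using 1 <;> ring
  have hc₂ : IsLatticeSystem E ϖ (stepRep ϖ (-n)) (1 - ((n : ℤ) + 1)) (2 - (n + 1)) := by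
    have := isLatticeSystem_stepRep hs hϖ (-n)
    convert this using 1 <;> ring
  have hKc : IsCompact (K : Set (G σ)) := isCompact_levelSet hs hϖ (by omega) le_rfl
  have hKo : IsOpen (K : Set (G σ)) := (isClopen_levelSet hϖ _ _).2
  have hne : (μ.real (K : Set (G σ)) : ℂ) ≠ 0 := by
    rw [Complex.ofReal_ne_zero]
    exact ENNReal.toReal_ne_zero.2 ⟨(hKo.measure_pos μ ⟨1, K.one_mem⟩).ne', hKc.measure_ne_top⟩
  rw [heckeT, hK, vectorIntegral_doubleCoset π μ K hKo hKc (zeta σ (ϖ : F) hϖ0)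
    (cosetRep hs hϖ0 (n + 1) (resRep s) (twoStepRep ϖ (-n - 1)) (stepRep ϖ (-n)))
    (cosetRep_mem hp hs hϖ hϖ0 (by omega) hX hc₁ hc₂)
    (fun g hg => existsUnique_cosetRep hp hs hϖ hϖ0 (by omega) le_rfl (by omega) (by omega)
      hX hc₁ hc₂ hg)
    (fun g hg => hv g (by rw [hK]; exact hg)), inv_smul_smul₀ hne, Fintype.sum_sum_type]
  rfl

/-- The vanishing of the trace of `π(ζ) v` to `K_n`, translated by `t_n`. -/
theorem sum_weyl_unip_add (hp : ringChar 𝓀[F] ≠ 2)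
    (hs : IsUnitSqrt σ s) (hϖ : Irreducible ϖ) (hϖ0 : (ϖ : F) ≠ 0) {n : ℕ} (hn : 1 ≤ n) {v : V}
    (hv : ∀ g ∈ levelSet σ ϖ (n + 1) n, π g v = v) (hbot : fixedK π ϖ n = ⊥) :
    ∑ p : (𝓀[F] × 𝓀[F]) × 𝓀[F],
        π (weyl σ (ϖ : F) hϖ0 n * unip hs (resRep s p.1) (stepRep ϖ (-n) p.2) *
          zeta σ (ϖ : F) hϖ0) v +
      ∑ x : 𝓀[F] × 𝓀[F], π (unip hs (resRep s x) 0 * zeta σ (ϖ : F) hϖ0) v = 0 := by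
  have hn' : (1 : ℤ) ≤ n := by exact_mod_cast hn
  let K := level hs hϖ (n := n) (by omega) (le_refl (n : ℤ))
  let L := level hs hϖ (n := n + 1) (m := n) (by omega) (by omega)
  have hX := isResidueSystem_resRep (F := F) hs hϖ
  have hc₁ : IsLatticeSystem E ϖ (stepRep ϖ (-n)) (-(n : ℤ)) (2 - (n + 1)) := by
    have := isLatticeSystem_stepRep hs hϖ (-n)
    convert this using 1; ring
  have hc₂ : IsLatticeSystem E ϖ (fun _ : Unit => (0 : F)) (1 - (n : ℤ)) (2 - (n + 1)) := by
    have := isLatticeSystem_unit (E := E) (ϖ := ϖ) (1 - (n : ℤ))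
    convert this using 1; ring
  have hinv := sum_cosets_invariant π K L (zeta σ (ϖ : F) hϖ0)
    (cosetRep hs hϖ0 n (resRep s) (stepRep ϖ (-n)) (fun _ : Unit => (0 : F)))
    (cosetRep_mem hp hs hϖ hϖ0 hn' hX hc₁ hc₂)
    (fun g hg => existsUnique_cosetRep hp hs hϖ hϖ0 hn' (by omega) le_rfl (by omega)
      hX hc₁ hc₂ hg) (v := v) hv
  have hmem : ∑ r, π (cosetRep hs hϖ0 n (resRep (F := F) s) (stepRep ϖ (-n)) (fun _ : Unit => (0 : F)) r *
      zeta σ (ϖ : F) hϖ0) v ∈ fixedK π ϖ n := by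
    intro g hg
    rw [K_eq_levelSet hϖ] at hg
    exact hinv g hg
  rw [hbot, Submodule.mem_bot, Fintype.sum_sum_type, Fintype.sum_prod_type (α₂ := Unit)] at hmem
  have h := congrArg (π (weyl σ (ϖ : F) hϖ0 n)) hmem
  simp only [cosetRep, Sum.elim_inl, Sum.elim_inr, Finset.univ_unique, Finset.sum_singleton,
    map_zero, map_add, map_sum, ← Module.End.mul_apply, ← map_mul] at h
  simpa only [← mul_assoc, weyl_mul_self, one_mul] using h

end Hecke

end U21

end

theorem lemma4p7
    {F : Type*} [Field F] [ValuativeRel F] [TopologicalSpace F] [IsNonarchimedeanLocalField F]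
    [CharZero F] (hp : ringChar 𝓀[F] ≠ 2)
    {E : Type*} [Field E] [ValuativeRel E] [TopologicalSpace E] [IsNonarchimedeanLocalField E]
    [Algebra F E] [ValuativeExtension F E] (hE : U21.IsUnramifiedQuadratic F E)
    (σ : E ≃ₐ[F] E) (hσ : σ ≠ 1)
    (ϖ : 𝒪[F]) (hϖ : Irreducible ϖ) (hϖ0 : (ϖ : F) ≠ 0)
    -- a Haar measure on `G`
    [MeasurableSpace (U21.G σ)] [BorelSpace (U21.G σ)]
    (μ : MeasureTheory.Measure (U21.G σ)) [μ.IsHaarMeasure]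
    (ψ : AddChar E ℂ) (hψc : Continuous ψ) (hψ : U21.HasConductorIntegers ϖ ψ)
    -- an irreducible smooth generic representation with its Whittaker functional
    {V : Type*} [AddCommGroup V] [Module ℂ V] (π : Representation ℂ (U21.G σ) V)
    (hirr : π.IsIrreducible) (hsm : U21.IsSmoothRep π)
    (l : Module.Dual ℂ V) (hl : l ∈ U21.whittakerFunctionals π ψ) (hl0 : l ≠ 0)
    (hN : 2 ≤ U21.conductor π ϖ)
    (hn : U21.centralConductor π ϖ < U21.conductor π ϖ)
    -- a vector of the space of newforms, and the Hecke eigenvalue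
    (v : V) (hv : v ∈ U21.fixedK π ϖ (U21.conductor π ϖ))
    (lam : ℂ) (hlam : U21.heckeT π μ ϖ hϖ0 (U21.conductor π ϖ) v = lam • v)
    (q : ℕ) (hq : q = Nat.card 𝓀[F])
    (c : ℤ → ℂ)
    (hc : ∀ i : ℤ, c i = U21.whittaker π l v (U21.zeta σ (ϖ : F) hϖ0 ^ i)) :
    lam * c 0 = (q : ℂ) ^ 4 * c 1 ∧
      ∀ i : ℤ, 1 ≤ i → (lam + (q : ℂ) ^ 2) * c i = (q : ℂ) ^ 4 * c (i + 1) := by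
  have := Fintype.ofFinite 𝓀[F]
  obtain ⟨s, hs⟩ := hE.exists_isUnitSqrt hp hσ
  obtain ⟨n, hnN⟩ : ∃ n, U21.conductor π ϖ = n + 1 := ⟨U21.conductor π ϖ - 1, by omega⟩
  have hn1 : 1 ≤ n := by omega
  have hbot : U21.fixedK π ϖ n = ⊥ := by
    by_contra h
    have : U21.conductor π ϖ ≤ n := Nat.sInf_le h
    omega
  have hz : ∀ z ∈ U21.Zn σ ϖ n, π z = 1 := fun z hz =>
    U21.apply_eq_one_of_mem_Zn hϖ hirr (by omega) (by omega) hz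
  rw [hnN] at hv hlam
  have hv' : ∀ g ∈ U21.levelSet σ ϖ (n + 1) n, π g v = v := fun g hg =>
    U21.apply_eq_self_of_mem_levelSet hp hs hϖ hn1
      (fun g hg => hv g (by rw [U21.K_eq_levelSet hϖ]; exact_mod_cast hg)) hz hg
  have hT := U21.heckeT_eq μ hp hs hϖ hϖ0 hn1 hv
  have hS := U21.sum_weyl_unip_add hp hs hϖ hϖ0 hn1 hv' hbot
  rw [hlam] at hT
  have hcard : Fintype.card 𝓀[F] = q := by rw [hq, Nat.card_eq_fintype_card]
  -- `ψ` is trivial on the `ϖ ^ i x` for `i ≥ 0`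
  have hψ1 : ∀ (i : ℤ) (x : 𝓀[F] × 𝓀[F]), 0 ≤ i →
      ψ (algebraMap F E (ϖ : F) ^ i * U21.resRep s x) = 1 := by
    intro i x hi
    have : algebraMap F E (ϖ : F) ^ i * U21.resRep s x ∈ U21.primePow ϖ 0 :=
      (U21.unif_zpow_mul_mem_iff hϖ i).2
        (U21.primePow_mono hϖ (by omega) ((U21.isResidueSystem_resRep hs hϖ).1 x))
    rw [U21.primePow_zero hϖ] at this
    exact hψ.1 ⟨_, this⟩
  have hmain : ∀ i : ℤ, 0 ≤ i → lam * c i = (q : ℂ) ^ 4 * c (i + 1) -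
      (∑ x : 𝓀[F] × 𝓀[F], ψ (algebraMap F E (ϖ : F) ^ (i - 1) * U21.resRep s x)) * c i := by
    intro i hi
    have h1 := congrArg (fun w => l (π (U21.zeta σ (ϖ : F) hϖ0 ^ i) w)) hT
    have h2 := congrArg (fun w => l (π (U21.zeta σ (ϖ : F) hϖ0 ^ (i - 1)) w)) hS
    simp only [map_add, map_sum, map_smul, map_zero, U21.whittaker_zeta_zpow_unip hs hϖ0 hl,
      hψ1 i _ hi, ← hc, sub_add_cancel, one_mul, smul_eq_mul, Finset.sum_const, Finset.card_univ,
      Fintype.card_prod, hcard, nsmul_eq_mul] at h1 h2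
    -- `ζ t_{n + 1} = t_n` identifies the sums over the small cells
    have h3 : ∀ p : (𝓀[F] × 𝓀[F]) × 𝓀[F],
        π (U21.zeta σ (ϖ : F) hϖ0 ^ i) (π (U21.weyl σ (ϖ : F) hϖ0 (n + 1) *
          U21.unip hs (U21.resRep s p.1) (U21.stepRep ϖ (-n) p.2) * U21.zeta σ (ϖ : F) hϖ0) v) =
        π (U21.zeta σ (ϖ : F) hϖ0 ^ (i - 1)) (π (U21.weyl σ (ϖ : F) hϖ0 n *
          U21.unip hs (U21.resRep s p.1) (U21.stepRep ϖ (-n) p.2) * U21.zeta σ (ϖ : F) hϖ0) v) := by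
      intro p
      rw [← Module.End.mul_apply, ← Module.End.mul_apply, ← map_mul, ← map_mul,
        ← U21.zeta_mul_weyl (ϖ : F) hϖ0 (n : ℤ)]
      congr 2
      rw [zpow_sub_one]
      group
    simp only [h3] at h1
    have h4 : l (π (U21.zeta σ (ϖ : F) hϖ0 ^ i) v) = c i := (hc i).symm
    rw [h4, eq_sub_of_add_eq h2, ← Finset.sum_mul] at h1
    push_cast at h1
    linear_combination h1
  refine ⟨?_, fun i hi => ?_⟩
  · have h := hmain 0 le_rfl
    have h0 := U21.sum_char_resRep hs hϖ hψ
    rw [zero_sub, zpow_neg_one] at h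
    rw [h, show algebraMap F E (ϖ : F) = U21.unif E ϖ from rfl, h0, zero_mul, sub_zero, zero_add]
  · have h := hmain i (by omega)
    simp only [hψ1 (i - 1) _ (by omega), Finset.sum_const, Finset.card_univ, Fintype.card_prod,
      hcard, nsmul_eq_mul, mul_one] at h
    push_cast at h
    linear_combination h
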